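/- Let $s,h\ge 1$ and $r\ge 3$ be integers. Then there is a constant $C=C(r,s,h)>0$ such that the following holds for all positive integers $a,b$ with $a+b=r$, where in the case $(a,b)=(1,r-1)$ it is assumed that $h=1$ and $s\ge 2$. Let $\mathcal H$ be an $r$-uniform hypergraph on $n$ vertices, and let its shadow $\partial\mathcal H$ be the family of all $(r-1)$-sets of vertices that are contained in some edge of $\mathcal H$. If $$|\mathcal H|>(s-1)\,|\partial\mathcal H|+C\,n^{r-2},$$ then $\mathcal H$ contains a copy of the $(a,b,s,h)$-bush $\mathcal B_{s,h}(a,b)$. Here $\mathcal B_{s,h}(a,b)$ is the $(a,b)$-blowup of the tree obtained from the star $K_{1,s}$ by joining each of its $s$ leaves to $h$ new vertices; that is, it is the $r$-uniform hypergraph whose edges are $A\cup B_i$ and $B_i\cup A_{i,j}$ for $1\le i\le s$, $1\le j\le h$, where $A$, $B_i$, $A_{i,j}$ are pairwise disjoint sets with $|A|=|A_{i,j}|=a$ and $|B_i|=b$. -/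

import Mathlib

/-- The graph bush `B_{s,h}`, given together with its bipartition. The left part
`Option (Fin s × Fin h)` consists of the center `none` and of the second neighbors `some (i, j)`
of the center; the right part `Fin s` consists of the neighbors of the center. The center is joined
to every `i : Fin s`, and each `i` is joined to the `h` further vertices `some (i, j)`. -/
def graphBush (s h : ℕ) : SimpleGraph (Option (Fin s × Fin h) ⊕ Fin s) :=
  SimpleGraph.fromRel fun x y =>
    ∃ i : Fin s, y = Sum.inr i ∧ (x = Sum.inl none ∨ ∃ j : Fin h, x = Sum.inl (some (i, j)))

/-- The edge set of the `(a, b)`-blowup of a bipartite graph `T` with parts `U` and `W`: each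
vertex `u` of `U` is replaced by the `a`-set `{u} × Fin a`, each vertex `w` of `W` by the `b`-set
`{w} × Fin b` (all these sets being pairwise disjoint), and the edges are the unions of the two sets
that belong to the ends of an edge `uw` of `T`. -/
def blowup {U W : Type*} (T : SimpleGraph (U ⊕ W)) (a b : ℕ) :
    Set (Finset ((U × Fin a) ⊕ (W × Fin b))) :=
  {e | ∃ (u : U) (w : W), T.Adj (Sum.inl u) (Sum.inr w) ∧
    e = (({u} : Finset U) ×ˢ (Finset.univ : Finset (Fin a))).disjSum
      (({w} : Finset W) ×ˢ (Finset.univ : Finset (Fin b)))}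

/-- The `(a, b, s, h)`-bush: the `(a, b)`-blowup of `graphBush s h`, where the center and its second
neighbors become `a`-sets and the neighbors of the center become `b`-sets. -/
def bush (s h a b : ℕ) :
    Set (Finset ((Option (Fin s × Fin h) × Fin a) ⊕ (Fin s × Fin b))) :=
  blowup (graphBush s h) a b

/-- The family `H` contains a copy of the hypergraph with edge set `F`: some injection of the
vertices of `F` maps every edge of `F` to a member of `H`. -/
def ContainsCopy {V X : Type*} (H : Finset (Finset V)) (F : Set (Finset X)) : Prop :=
  ∃ f : X ↪ V, ∀ e ∈ F, e.map f ∈ H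

/-!
The proof uses the delta-system method. A family of rainbow edges (with respect to a vertex colouring
by `r` colours) is *homogeneous* if its traces on all colour sets of some family `J` are kernels of
large sunflowers, where `J` is closed under intersections and every set of `r - 2` colours lies in a
member of `J` other than the set of all colours. `exists_small_exceptional` shows that all but
`O(n ^ (r - 2))` edges of `H` lie in homogeneous subfamilies: a family of rainbow edges is split recursively into boundedly many
pieces, each of which either is stable or forbids one more intersection pattern; a stable piece
is homogeneous or has an uncovered set of `r - 2` colours, hence at most `n ^ (r - 2)` edges.
Averaging over all colourings removes the assumption that edges are rainbow.

If `J` contains some `a`-set and its complement, a bush is found greedily. Otherwise `J` is almost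
determined: either it contains all sets through one colour, or all colours are *loose*
(and `a` or `b` is `1`), or `(a, b) = (2, 2)` with exactly three loose colours.

For `a ≥ 2`, consider pairs `A ⊆ D` with `D` in the shadow and `#A = a`. An edge `insert x D` is
anchored at `(D, A)` if `A ∪ {x}` and the complement of `A` are kernels; without a bush each pair
has at most `s - 1` anchored edges (`card_anchored_lt`). In all cases a homogeneous edge has at
least `(r - 1).choose a` anchors, which is the number of pairs for a fixed `D`
(`choose_le_card_anchors`), so double counting gives `s - 1` edges per element of the shadow.

For `a = 1` an edge is a star, charged to the facet opposite to its center, or full: all sets of at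
most `r - 2` vertices are kernels, of which only single vertices are needed. A facet of a full edge has at most `s`
extensions (`IsFull.card_nbr_le`), and unless the edge is also a star, at most one of its facets is
charged by `s - 1` stars (`IsFull.eq_of_le_card_starNbr`). Charging a full edge with weight `1 / 2`
to two of its other facets again gives total charge at most `s - 1` per element of the shadow
(`card_le_of_isStar_or_isFull`).
-/

namespace BushTuran
open Finset

/-! ### Homogeneous families -/

section Families

variable {V : Type*} {r q : ℕ}

/-- The vertices of `e` whose colour belongs to `P`. -/
def part (κ : V → Fin r) (P : Finset (Fin r)) (e : Finset V) : Finset V :=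
  e.filter fun v => κ v ∈ P

/-- The set `e` contains exactly one vertex of every colour. -/
structure Rainbow (κ : V → Fin r) (e : Finset V) : Prop where
  injOn : Set.InjOn κ e
  image_eq : e.image κ = univ

theorem mem_part {κ : V → Fin r} {P : Finset (Fin r)} {e : Finset V} {v : V} :
    v ∈ part κ P e ↔ v ∈ e ∧ κ v ∈ P := by simp [part]

theorem part_subset (κ : V → Fin r) (P : Finset (Fin r)) (e : Finset V) : part κ P e ⊆ e :=
  filter_subset _ _

@[simp] theorem part_univ (κ : V → Fin r) (e : Finset V) : part κ univ e = e := by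
  simp [part]

namespace Rainbow

variable {κ : V → Fin r} {e : Finset V}

theorem card_eq (h : Rainbow κ e) : #e = r := by
  rw [← card_image_of_injOn h.injOn, h.image_eq, card_univ, Fintype.card_fin]

theorem exists_mem (h : Rainbow κ e) (p : Fin r) : ∃ v ∈ e, κ v = p := by
  have : p ∈ e.image κ := by rw [h.image_eq]; exact mem_univ p
  simpa using this

theorem image_part (h : Rainbow κ e) (P : Finset (Fin r)) : (part κ P e).image κ = P := by
  ext p
  simp only [mem_image, mem_part]
  constructor
  · rintro ⟨v, ⟨_, hv⟩, rfl⟩; exact hv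
  · intro hp
    obtain ⟨v, hv, rfl⟩ := h.exists_mem p
    exact ⟨v, ⟨hv, hp⟩, rfl⟩

theorem card_part (h : Rainbow κ e) (P : Finset (Fin r)) : #(part κ P e) = #P := by
  conv_rhs => rw [← h.image_part P]
  exact (card_image_of_injOn (h.injOn.mono (part_subset κ P e))).symm

theorem of_card (h : Set.InjOn κ e) (hc : #e = r) : Rainbow κ e := by
  refine ⟨h, ?_⟩
  rw [← card_eq_iff_eq_univ, card_image_of_injOn h, hc, Fintype.card_fin]

end Rainbow

theorem Rainbow.part_image {κ : V → Fin r} {e : Finset V} (h : Rainbow κ e) {K : Finset V}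
    (hK : K ⊆ e) : part κ (K.image κ) e = K := by
  ext v
  simp only [mem_part, mem_image]
  constructor
  · rintro ⟨hv, w, hw, hwv⟩
    rwa [← h.injOn (hK hw) hv hwv]
  · exact fun hv => ⟨hK hv, v, hv, rfl⟩

theorem part_singleton {κ : V → Fin r} {e : Finset V} (he : Rainbow κ e) {v : V} (hv : v ∈ e) :
    part κ {κ v} e = {v} := by
  ext w
  simp only [mem_part, mem_singleton]
  constructor
  · exact fun h => he.injOn h.1 hv h.2
  · rintro rfl; exact ⟨hv, rfl⟩

theorem card_le_of_part_injOn [Fintype V] {κ : V → Fin r} {G : Finset (Finset V)}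
    (hr : ∀ e ∈ G, Rainbow κ e) {P : Finset (Fin r)} (h : Set.InjOn (part κ P) G) :
    #G ≤ Fintype.card V ^ #P := by
  calc #G ≤ #(powersetCard #P (univ : Finset V)) :=
        card_le_card_of_injOn (part κ P)
          (fun e he => by simpa using (hr e he).card_part P) h
    _ = (Fintype.card V).choose #P := by rw [card_powersetCard, card_univ]
    _ ≤ _ := Nat.choose_le_pow _ _

variable [DecidableEq V]

theorem part_compl (κ : V → Fin r) (P : Finset (Fin r)) (e : Finset V) :
    part κ Pᶜ e = e \ part κ P e := by
  ext v; simp only [mem_part, mem_sdiff, mem_compl]; tauto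

theorem part_inter (κ : V → Fin r) (P Q : Finset (Fin r)) (e : Finset V) :
    part κ (P ∩ Q) e = part κ P e ∩ part κ Q e := by
  ext v; simp only [mem_part, mem_inter]; tauto

/-- Every trace on `P` of an edge of `G` is the kernel of a large sunflower of `G`. Sunflowers are
encoded by avoidance: any `q` vertices can be avoided outside the kernel. -/
def IsKernel (q : ℕ) (κ : V → Fin r) (G : Finset (Finset V)) (P : Finset (Fin r)) : Prop :=
  ∀ e ∈ G, ∀ W : Finset V, #W ≤ q →
    ∃ f ∈ G, part κ P f = part κ P e ∧ Disjoint (f \ part κ P e) W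

/-- No two distinct edges of `G` meet in a set with colour set `P`. -/
def Excludes (κ : V → Fin r) (G : Finset (Finset V)) (P : Finset (Fin r)) : Prop :=
  ∀ e ∈ G, ∀ f ∈ G, e ≠ f → (e ∩ f).image κ ≠ P

theorem Excludes.mono {κ : V → Fin r} {G G' : Finset (Finset V)} {P : Finset (Fin r)}
    (h : Excludes κ G P) (hG : G' ⊆ G) : Excludes κ G' P :=
  fun e he f hf => h e (hG he) f (hG hf)

/-- A homogeneous family in the sense of the delta-system method: all edges are rainbow, every
trace with colour set in `J` is the kernel of a large sunflower, `J` is closed under intersections,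
and every set of `r - 2` colours is contained in a proper member of `J`. -/
structure Homogeneous (q : ℕ) (κ : V → Fin r) (G : Finset (Finset V))
    (J : Finset (Finset (Fin r))) : Prop where
  rainbow : ∀ e ∈ G, Rainbow κ e
  kernel : ∀ P ∈ J, IsKernel q κ G P
  univ_mem : univ ∈ J
  inter_mem : ∀ P ∈ J, ∀ Q ∈ J, P ∩ Q ∈ J
  cover : ∀ p p' : Fin r, p ≠ p' → {p}ᶜ ∈ J ∨ {p'}ᶜ ∈ J ∨ {p, p'}ᶜ ∈ J

/-- Repeatedly removing all edges through a set that is not the kernel of a sunflower leaves a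
family in which all traces on colour sets outside `X` are kernels. The removed edges are sorted by
the colour set responsible for their removal. -/
theorem exists_stable_subfamily (q : ℕ) (κ : V → Fin r) (X : Finset (Finset (Fin r)))
    (G₀ : Finset (Finset V)) :
    ∃ (G : Finset (Finset V)) (D : Finset (Fin r) → Finset (Finset V)),
      G ⊆ G₀ ∧ (∀ P ∉ X, IsKernel q κ G P) ∧ (∀ e ∈ G₀, e ∈ G ∨ ∃ P ∉ X, e ∈ D P) ∧
      ∀ P, D P ⊆ G₀ ∧ ∀ e ∈ D P, ∃ W : Finset V, #W ≤ q ∧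
        ∀ f ∈ D P, part κ P f = part κ P e → ¬ Disjoint (f \ part κ P e) W := by
  classical
  induction G₀ using Finset.strongInduction with
  | H G₀ ih =>
    by_cases hst : ∀ P ∉ X, IsKernel q κ G₀ P
    · exact ⟨G₀, fun _ => ∅, subset_rfl, hst, fun e he => Or.inl he, fun P => by simp⟩
    · simp only [IsKernel] at hst
      push Not at hst
      obtain ⟨P, hP, e, he, W, hW, hav⟩ := hst
      set T := G₀.filter fun f => part κ P f = part κ P e with hT
      have heT : e ∈ T := by simp [hT, he]
      have hss : G₀ \ T ⊂ G₀ :=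
        ⟨sdiff_subset, fun h => (mem_sdiff.1 (h he)).2 heT⟩
      obtain ⟨G, D, hG, hstab, hcov, hD⟩ := ih _ hss
      refine ⟨G, fun Q => if Q = P then D P ∪ T else D Q, hG.trans sdiff_subset, hstab, ?_, ?_⟩
      · intro f hf
        by_cases hfT : f ∈ T
        · exact Or.inr ⟨P, hP, by simp [hfT]⟩
        · rcases hcov f (mem_sdiff.2 ⟨hf, hfT⟩) with h | ⟨Q, hQ, h⟩
          · exact Or.inl h
          · refine Or.inr ⟨Q, hQ, ?_⟩
            by_cases hQP : Q = P
            · subst hQP; simp [h]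
            · simpa [hQP] using h
      · intro Q
        dsimp only
        split_ifs with hQP
        · subst hQP
          refine ⟨union_subset ((hD Q).1.trans sdiff_subset) (filter_subset _ _), ?_⟩
          intro f hf
          rcases mem_union.1 hf with hf | hf
          · obtain ⟨W', hW', hav'⟩ := (hD Q).2 f hf
            refine ⟨W', hW', fun g hg hgf => ?_⟩
            rcases mem_union.1 hg with hg | hg
            · exact hav' g hg hgf
            · exfalso
              have h1 := (mem_sdiff.1 ((hD Q).1 hf))
              apply h1.2
              rw [hT, mem_filter] at hg ⊢
              exact ⟨h1.1, hgf.symm.trans hg.2⟩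
          · have hfe : part κ Q f = part κ Q e := (mem_filter.1 hf).2
            refine ⟨W, hW, fun g hg hgf => ?_⟩
            rw [hfe] at hgf ⊢
            refine hav g ?_ hgf
            rcases mem_union.1 hg with hg | hg
            · exact (mem_sdiff.1 ((hD Q).1 hg)).1
            · exact (mem_filter.1 hg).1
        · exact ⟨(hD Q).1.trans sdiff_subset, (hD Q).2⟩

theorem exists_injOn_fin {α : Type*} [DecidableEq α] (hq : 0 < q) (W : Finset α) (hW : #W ≤ q) :
    ∃ φ : α → Fin q, Set.InjOn φ W := by
  have : Nonempty (Fin q) := ⟨⟨0, hq⟩⟩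
  obtain ⟨f⟩ : Nonempty (W ↪ Fin q) :=
    Function.Embedding.nonempty_of_card_le (by simpa using hW)
  refine ⟨fun x => if h : x ∈ W then f ⟨x, h⟩ else ⟨0, hq⟩, ?_⟩
  intro x hx y hy hxy
  have hx' : x ∈ W := hx
  have hy' : y ∈ W := hy
  simp only [hx', hy', dif_pos] at hxy
  simpa using f.injective hxy

/-- A family without large sunflowers with traces on `P` as kernels splits into `q` subfamilies
that exclude `P`: edges with a common trace are sorted by a vertex of a small set that they all
meet outside the trace. -/
theorem exists_excluding_split (hq : 0 < q) {κ : V → Fin r} {D : Finset (Finset V)}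
    (hr : ∀ e ∈ D, Rainbow κ e) {P : Finset (Fin r)}
    (hD : ∀ e ∈ D, ∃ W : Finset V, #W ≤ q ∧
      ∀ f ∈ D, part κ P f = part κ P e → ¬ Disjoint (f \ part κ P e) W) :
    ∃ c : Finset V → Fin q, ∀ j, Excludes κ (D.filter fun e => c e = j) P := by
  classical
  have hW : ∀ K : Finset V, ∃ W : Finset V, #W ≤ q ∧
      ∀ f ∈ D, part κ P f = K → ¬ Disjoint (f \ K) W := by
    intro K
    by_cases h : ∃ e ∈ D, part κ P e = K
    · obtain ⟨e, he, rfl⟩ := h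
      exact hD e he
    · exact ⟨∅, by simp, fun f hf hfK => (h ⟨f, hf, hfK⟩).elim⟩
  choose W hWc hWd using hW
  choose φ hφ using fun K => exists_injOn_fin hq (W K) (hWc K)
  have hw : ∀ f : Finset V, ∃ x : Fin q, f ∈ D →
      ∃ v, v ∈ f ∧ v ∉ part κ P f ∧ v ∈ W (part κ P f) ∧ φ (part κ P f) v = x := by
    intro f
    by_cases hf : f ∈ D
    · obtain ⟨v, hv, hv'⟩ := not_disjoint_iff.1 (hWd _ f hf rfl)
      rw [mem_sdiff] at hv
      exact ⟨_, fun _ => ⟨v, hv.1, hv.2, hv', rfl⟩⟩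
    · exact ⟨⟨0, hq⟩, fun h => (hf h).elim⟩
  choose c hc using hw
  refine ⟨c, fun j e he f hf hef him => ?_⟩
  rw [mem_filter] at he hf
  have h1 : part κ P e = e ∩ f := by rw [← him, (hr e he.1).part_image inter_subset_left]
  have h2 : part κ P f = e ∩ f := by rw [← him, (hr f hf.1).part_image inter_subset_right]
  obtain ⟨v, hve, hvP, hvW, hv⟩ := hc e he.1
  obtain ⟨w, hwf, hwP, hwW, hw⟩ := hc f hf.1
  rw [h1] at hvP hvW hv
  rw [h2] at hwP hwW hw
  have hvw : v = w := hφ _ hvW hwW (by rw [hv, hw, he.2, hf.2])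
  subst hvw
  exact hvP (mem_inter.2 ⟨hve, hwf⟩)

theorem part_inter_of_kernels {κ : V → Fin r} {G : Finset (Finset V)} (hq : 2 * r ≤ q)
    (hr : ∀ e ∈ G, Rainbow κ e) {P Q : Finset (Fin r)} (hP : IsKernel q κ G P)
    (hQ : IsKernel q κ G Q) {e : Finset V} (he : e ∈ G) :
    ∃ f ∈ G, ∃ g ∈ G, (f ∩ g).image κ = P ∩ Q := by
  obtain ⟨f, hf, hfP, hfd⟩ := hP e he e (by rw [(hr e he).card_eq]; omega)
  obtain ⟨g, hg, hgQ, hgd⟩ := hQ e he (e ∪ f) (by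
    have := card_union_le e f
    rw [(hr e he).card_eq, (hr f hf).card_eq] at this; omega)
  refine ⟨f, hf, g, hg, ?_⟩
  suffices h : f ∩ g = part κ (P ∩ Q) e by rw [h, (hr e he).image_part]
  rw [part_inter]
  ext v
  simp only [mem_inter]
  constructor
  · rintro ⟨hvf, hvg⟩
    have hvQ : v ∈ part κ Q e := by
      by_contra hn
      exact disjoint_left.1 hgd (mem_sdiff.2 ⟨hvg, hn⟩) (mem_union_right _ hvf)
    refine ⟨?_, hvQ⟩
    by_contra hn
    exact disjoint_left.1 hfd (mem_sdiff.2 ⟨hvf, hn⟩) (part_subset _ _ _ hvQ)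
  · rintro ⟨hv1, hv2⟩
    rw [← hfP] at hv1
    rw [← hgQ] at hv2
    exact ⟨part_subset _ _ _ hv1, part_subset _ _ _ hv2⟩

/-- A family in which all non-excluded traces are kernels is homogeneous, unless it is small. -/
theorem homogeneous_or_card_le [Fintype V] (hq : 2 * r ≤ q) {κ : V → Fin r}
    {G : Finset (Finset V)} (hr : ∀ e ∈ G, Rainbow κ e) {X : Finset (Finset (Fin r))}
    (hX : ∀ P ∈ X, Excludes κ G P) (hst : ∀ P ∉ X, IsKernel q κ G P) :
    (∃ J, Homogeneous q κ G J) ∨ #G ≤ Fintype.card V ^ (r - 2) := by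
  classical
  rcases G.eq_empty_or_nonempty with rfl | ⟨e₀, he₀⟩
  · right; simp
  have hun : IsKernel q κ G univ := fun e he W _ => ⟨e, he, rfl, by simp⟩
  have hker : ∀ P ∈ insert univ Xᶜ, IsKernel q κ G P := by
    intro P hP
    rcases mem_insert.1 hP with rfl | hP
    · exact hun
    · exact hst P (mem_compl.1 hP)
  have himg : ∀ f ∈ G, ∀ g ∈ G, (f ∩ g).image κ ∈ insert univ Xᶜ := by
    intro f hf g hg
    by_cases hfg : f = g
    · subst hfg
      rw [inter_self, (hr f hf).image_eq]
      exact mem_insert_self _ _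
    · refine mem_insert_of_mem (mem_compl.2 fun h => ?_)
      exact hX _ h f hf g hg hfg rfl
  by_cases hc : ∀ p p' : Fin r, p ≠ p' →
      {p}ᶜ ∈ insert univ Xᶜ ∨ {p'}ᶜ ∈ insert univ Xᶜ ∨ {p, p'}ᶜ ∈ insert univ Xᶜ
  · refine Or.inl ⟨insert univ Xᶜ, hr, hker, mem_insert_self _ _, ?_, hc⟩
    intro P hP Q hQ
    obtain ⟨f, hf, g, hg, h⟩ := part_inter_of_kernels hq hr (hker P hP) (hker Q hQ) he₀
    rw [← h]
    exact himg f hf g hg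
  · push Not at hc
    obtain ⟨p, p', hpp, h1, h2, h3⟩ := hc
    right
    have hcard : #({p, p'}ᶜ : Finset (Fin r)) = r - 2 := by
      rw [card_compl, card_pair hpp, Fintype.card_fin]
    rw [← hcard]
    refine card_le_of_part_injOn hr ?_
    intro e he f hf hef
    have he' : e ∈ G := he
    have hf' : f ∈ G := hf
    have hsub : part κ {p, p'}ᶜ e ⊆ e ∩ f :=
      subset_inter (part_subset _ _ _) (hef ▸ part_subset _ _ _)
    have hsub' : ({p, p'}ᶜ : Finset (Fin r)) ⊆ (e ∩ f).image κ := by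
      have := image_subset_image (f := κ) hsub
      rwa [(hr e he').image_part] at this
    have hmem := himg e he' f hf'
    set Q := (e ∩ f).image κ with hQ
    -- the colour sets between `{p, p'}ᶜ` and `univ` are four in number
    have hQu : Q = univ := by
      by_contra hne
      by_cases hp : p ∈ Q
      · by_cases hp' : p' ∈ Q
        · apply hne
          ext x
          simp only [mem_univ, iff_true]
          by_cases hx : x = p
          · rwa [hx]
          · by_cases hx' : x = p'
            · rwa [hx']
            · exact hsub' (by simp [hx, hx'])
        · apply h2
          have : ({p'}ᶜ : Finset (Fin r)) = Q := by
            ext x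
            simp only [mem_compl, mem_singleton]
            constructor
            · intro hx'
              by_cases hx : x = p
              · rwa [hx]
              · exact hsub' (by simp [hx, hx'])
            · rintro hx rfl; exact hp' hx
          rwa [this]
      · by_cases hp' : p' ∈ Q
        · apply h1
          have : ({p}ᶜ : Finset (Fin r)) = Q := by
            ext x
            simp only [mem_compl, mem_singleton]
            constructor
            · intro hx
              by_cases hx' : x = p'
              · rwa [hx']
              · exact hsub' (by simp [hx, hx'])
            · rintro hx rfl; exact hp hx
          rwa [this]
        · apply h3
          have : ({p, p'}ᶜ : Finset (Fin r)) = Q := by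
            refine Subset.antisymm hsub' fun x hx => ?_
            simp only [mem_compl, mem_insert, mem_singleton, not_or]
            exact ⟨fun h => hp (h ▸ hx), fun h => hp' (h ▸ hx)⟩
          rwa [this]
    have hre := (hr e he').part_image (K := e ∩ f) inter_subset_left
    have hrf := (hr f hf').part_image (K := e ∩ f) inter_subset_right
    rw [← hQ, hQu, part_univ] at hre hrf
    exact hre.trans hrf.symm

/-- All but `O(n ^ (r - 2))` edges of a rainbow family lie in homogeneous subfamilies. The induction
is on the number of colour sets that are not yet excluded. -/
theorem exists_small_exceptional_of_rainbow (hq : 2 * r ≤ q) (hq0 : 0 < q) (n : ℕ) :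
    ∃ M : ℕ, ∀ (V : Type*) [Fintype V] [DecidableEq V] (κ : V → Fin r) (H : Finset (Finset V))
      (X : Finset (Finset (Fin r))), #Xᶜ ≤ n → (∀ e ∈ H, Rainbow κ e) →
      (∀ P ∈ X, Excludes κ H P) →
      ∃ B ⊆ H, #B ≤ M * Fintype.card V ^ (r - 2) ∧
        ∀ e ∈ H, e ∉ B → ∃ G ⊆ H, e ∈ G ∧ ∃ J, Homogeneous q κ G J := by
  classical
  induction n with
  | zero =>
    refine ⟨1, fun V _ _ κ H X hX hr hex => ?_⟩
    have hX' : ∀ P, P ∈ X := by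
      intro P
      by_contra h
      have := card_pos.2 ⟨P, mem_compl.2 h⟩
      omega
    rcases homogeneous_or_card_le hq hr hex (fun P hP => (hP (hX' P)).elim) with h | h
    · exact ⟨∅, by simp, by simp, fun e he _ => ⟨H, subset_rfl, he, h⟩⟩
    · exact ⟨H, subset_rfl, by simpa using h, fun e he h => (h he).elim⟩
  | succ n ih =>
    obtain ⟨M, ih⟩ := ih
    refine ⟨1 + 2 ^ r * (q * M), fun V _ _ κ H X hX hr hex => ?_⟩
    set N := Fintype.card V ^ (r - 2) with hN
    obtain ⟨G, D, hG, hst, hcov, hD⟩ := exists_stable_subfamily q κ X H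
    have hsplit : ∀ P, ∃ c : Finset V → Fin q,
        ∀ j, Excludes κ ((D P).filter fun e => c e = j) P := fun P =>
      exists_excluding_split hq0 (fun e he => hr e ((hD P).1 he)) (hD P).2
    choose c hc using hsplit
    have hpiece : ∀ P : Finset (Fin r), ∀ j : Fin q, ∃ B : Finset (Finset V), P ∉ X →
        B ⊆ H ∧ #B ≤ M * N ∧ ∀ e ∈ D P, c P e = j → e ∉ B →
          ∃ G ⊆ H, e ∈ G ∧ ∃ J, Homogeneous q κ G J := by
      intro P j
      by_cases hP : P ∈ X
      · exact ⟨∅, fun h => (h hP).elim⟩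
      have hsub : ((D P).filter fun e => c P e = j) ⊆ H := (filter_subset _ _).trans (hD P).1
      obtain ⟨B, hB, hBc, hBg⟩ := ih V κ ((D P).filter fun e => c P e = j) (insert P X)
        (by
          have h1 : (insert P X)ᶜ = Xᶜ.erase P := by
            ext Q; simp only [mem_compl, mem_insert, mem_erase]; tauto
          rw [h1, card_erase_of_mem (mem_compl.2 hP)]; omega)
        (fun e he => hr e (hsub he))
        (fun Q hQ => by
          rcases mem_insert.1 hQ with rfl | hQ
          · exact hc _ j
          · exact (hex Q hQ).mono hsub)
      refine ⟨B, fun _ => ⟨hB.trans hsub, hBc, fun e he hej heB => ?_⟩⟩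
      obtain ⟨G', hG', heG', J⟩ := hBg e (mem_filter.2 ⟨he, hej⟩) heB
      exact ⟨G', hG'.trans hsub, heG', J⟩
    choose B hB using hpiece
    obtain ⟨B₀, hB₀, hB₀c, hB₀g⟩ : ∃ B₀ ⊆ H, #B₀ ≤ N ∧
        ∀ e ∈ G, e ∉ B₀ → ∃ G ⊆ H, e ∈ G ∧ ∃ J, Homogeneous q κ G J := by
      rcases homogeneous_or_card_le hq (fun e he => hr e (hG he))
        (fun P hP => (hex P hP).mono hG) hst with h | h
      · exact ⟨∅, by simp, by simp, fun e he _ => ⟨G, hG, he, h⟩⟩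
      · exact ⟨G, hG, h, fun e he h => (h he).elim⟩
    refine ⟨B₀ ∪ Xᶜ.biUnion fun P => univ.biUnion (B P), ?_, ?_, ?_⟩
    · refine union_subset hB₀ (biUnion_subset.2 fun P hP => biUnion_subset.2 fun j _ => ?_)
      exact (hB P j (mem_compl.1 hP)).1
    · calc _ ≤ #B₀ + #(Xᶜ.biUnion fun P => univ.biUnion (B P)) := card_union_le _ _
        _ ≤ N + #Xᶜ * (q * (M * N)) := by
          refine add_le_add hB₀c (card_biUnion_le_card_mul _ _ _ fun P hP => ?_)
          refine (card_biUnion_le_card_mul _ _ (M * N) fun j _ => ?_).trans (by simp)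
          exact (hB P j (mem_compl.1 hP)).2.1
        _ ≤ N + 2 ^ r * (q * (M * N)) := by
          gcongr
          refine (card_le_univ _).trans (le_of_eq ?_)
          simp [Fintype.card_finset]
        _ = _ := by ring
    · intro e he heB
      rw [mem_union, not_or] at heB
      rcases hcov e he with h | ⟨P, hP, h⟩
      · exact hB₀g e h heB.1
      · refine (hB P (c P e) hP).2.2 e h rfl fun hmem => heB.2 ?_
        exact mem_biUnion.2 ⟨P, mem_compl.2 hP, mem_biUnion.2 ⟨_, mem_univ _, hmem⟩⟩

theorem pow_le_card_rainbow_mul [Fintype V] {e : Finset V} (he : #e = r) :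
    r ^ Fintype.card V ≤ #{κ : V → Fin r | Set.InjOn κ e} * r ^ r := by
  classical
  obtain ⟨φ⟩ : Nonempty (e ≃ Fin r) := ⟨Fintype.equivFinOfCardEq (by simpa using he)⟩
  have hinj : Fintype.card ({v // v ∉ e} → Fin r) ≤ #{κ : V → Fin r | Set.InjOn κ e} := by
    rw [← card_univ]
    refine card_le_card_of_injOn
      (fun g v => if h : v ∈ e then φ ⟨v, h⟩ else g ⟨v, h⟩) ?_ ?_
    · intro g _
      simp only [coe_filter, mem_univ, true_and, Set.mem_ofPred_eq]
      intro x hx y hy hxy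
      have hx' : x ∈ e := hx
      have hy' : y ∈ e := hy
      simp only [hx', hy', dif_pos] at hxy
      simpa using hxy
    · intro g _ g' _ hgg
      ext ⟨v, hv⟩
      have := congrFun hgg v
      simp only [hv, dif_neg, not_false_iff] at this
      rw [this]
  rw [Fintype.card_fun, Fintype.card_fin, Fintype.card_subtype_compl, Fintype.card_coe, he] at hinj
  calc r ^ Fintype.card V = r ^ (Fintype.card V - r) * r ^ r := by
        rw [← pow_add, Nat.sub_add_cancel]
        rw [← he]; exact card_le_univ e
    _ ≤ _ := Nat.mul_le_mul_right _ hinj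

/-- **Delta-system decomposition.** All but `O(n ^ (r - 2))` edges of an `r`-uniform hypergraph `H`
lie in homogeneous subfamilies of `H`, on which moreover a given bounded colouring `χ` of the edges
is constant. A random vertex colouring `κ` makes an edge rainbow with positive probability, so few
edges are exceptional for all the colourings that make them rainbow. -/
theorem exists_small_exceptional (hq : 2 * r ≤ q) (hq0 : 0 < q) (hr0 : 0 < r) (T : Type)
    [Fintype T] [DecidableEq T] :
    ∃ M : ℕ, ∀ (V : Type*) [Fintype V] [DecidableEq V] (H : Finset (Finset V))
      (χ : (V → Fin r) → Finset V → T), (∀ e ∈ H, #e = r) →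
      ∃ B ⊆ H, #B ≤ M * Fintype.card V ^ (r - 2) ∧
        ∀ e ∈ H, e ∉ B → ∃ G ⊆ H, e ∈ G ∧ ∃ κ J, Homogeneous q κ G J ∧
          ∀ f ∈ G, χ κ f = χ κ e := by
  classical
  obtain ⟨M, hM⟩ := exists_small_exceptional_of_rainbow (r := r) hq hq0
    (Fintype.card (Finset (Fin r)))
  refine ⟨r ^ r * (Fintype.card T * M), fun V _ _ H χ hH => ?_⟩
  set N := Fintype.card V ^ (r - 2) with hN
  have hκ : ∀ κ : V → Fin r, ∃ B ⊆ H, #B ≤ Fintype.card T * (M * N) ∧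
      ∀ e ∈ H, Rainbow κ e → e ∉ B → ∃ G ⊆ H, e ∈ G ∧ ∃ J, Homogeneous q κ G J ∧
        ∀ f ∈ G, χ κ f = χ κ e := by
    intro κ
    have ht : ∀ t : T, ∃ B ⊆ H, #B ≤ M * N ∧
      ∀ e ∈ H, Rainbow κ e → χ κ e = t → e ∉ B → ∃ G ⊆ H, e ∈ G ∧ ∃ J, Homogeneous q κ G J ∧
        ∀ f ∈ G, χ κ f = χ κ e := by
      intro t
      obtain ⟨B, hB, hBc, hBg⟩ := hM V κ (H.filter fun e => Rainbow κ e ∧ χ κ e = t) ∅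
        (card_le_univ _) (fun e he => (mem_filter.1 he).2.1) (by simp)
      refine ⟨B, hB.trans (filter_subset _ _), hBc, fun e he hr het heB => ?_⟩
      obtain ⟨G, hG, heG, J, hJ⟩ := hBg e (mem_filter.2 ⟨he, hr, het⟩) heB
      exact ⟨G, hG.trans (filter_subset _ _), heG, J, hJ, fun f hf => by
        rw [het, (mem_filter.1 (hG hf)).2.2]⟩
    choose B hB hBc hBg using ht
    refine ⟨univ.biUnion B, biUnion_subset.2 fun t _ => hB t,
      (card_biUnion_le_card_mul _ _ _ fun t _ => hBc t).trans (by simp), ?_⟩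
    intro e he hr heB
    exact hBg (χ κ e) e he hr rfl fun h => heB (mem_biUnion.2 ⟨_, mem_univ _, h⟩)
  choose B hB hBc hBg using hκ
  refine ⟨H.filter fun e : Finset V => ∀ κ : V → Fin r, Set.InjOn κ e → e ∈ B κ,
    filter_subset _ _, ?_, ?_⟩
  · set E := H.filter fun e : Finset V => ∀ κ : V → Fin r, Set.InjOn κ e → e ∈ B κ with hE
    have hdc := sum_card_bipartiteAbove_eq_sum_card_bipartiteBelow (s := E)
      (t := (univ : Finset (V → Fin r)))
      (fun (e : Finset V) (κ : V → Fin r) => Set.InjOn κ (e : Set V))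
    have hlow : #E * r ^ Fintype.card V ≤
        (∑ e ∈ E, #(bipartiteAbove (fun (e : Finset V) (κ : V → Fin r) =>
          Set.InjOn κ (e : Set V)) univ e)) * r ^ r := by
      rw [sum_mul]
      refine le_trans (le_of_eq ?_) (sum_le_sum fun e he =>
        pow_le_card_rainbow_mul (hH e (mem_filter.1 he).1))
      simp
    have hup : ∑ κ : V → Fin r, #(bipartiteBelow (fun (e : Finset V) (κ : V → Fin r) =>
          Set.InjOn κ (e : Set V)) E κ) ≤ r ^ Fintype.card V * (Fintype.card T * (M * N)) := by
      refine (sum_le_card_nsmul _ _ (Fintype.card T * (M * N)) fun κ _ => ?_).trans (by simp)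
      refine (card_le_card fun e he => ?_).trans (hBc κ)
      rw [bipartiteBelow, mem_filter] at he
      exact (mem_filter.1 he.1).2 κ he.2
    rw [hdc] at hlow
    have hpos : 0 < r ^ Fintype.card V := pow_pos hr0 _
    refine Nat.le_of_mul_le_mul_right ?_ hpos
    calc #E * r ^ Fintype.card V ≤ _ := hlow
      _ ≤ (r ^ Fintype.card V * (Fintype.card T * (M * N))) * r ^ r :=
          Nat.mul_le_mul_right _ hup
      _ = _ := by ring
  · intro e he heB
    rw [mem_filter, not_and] at heB
    have := heB he
    push Not at this
    obtain ⟨κ, hκ, heκ⟩ := this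
    obtain ⟨G, hG, heG, J, hJ⟩ := hBg κ e he (Rainbow.of_card hκ (hH e he)) heκ
    exact ⟨G, hG, heG, κ, J, hJ⟩

end Families

/-! ### Kernel patterns of homogeneous families -/

section Pattern

variable {r : ℕ} {J : Finset (Finset (Fin r))}

theorem biUnion_compl_mem (hu : univ ∈ J) (hi : ∀ P ∈ J, ∀ Q ∈ J, P ∩ Q ∈ J) {ι : Type*}
    [DecidableEq ι] (S : Finset ι) (F : ι → Finset (Fin r)) (hF : ∀ i ∈ S, (F i)ᶜ ∈ J) :
    (S.biUnion F)ᶜ ∈ J := by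
  induction S using Finset.induction_on with
  | empty => simpa using hu
  | insert i S _ ih =>
    rw [biUnion_insert, compl_union]
    exact hi _ (hF i (mem_insert_self _ _)) _ (ih fun j hj => hF j (mem_insert_of_mem hj))

/-- The colours `p` for which the traces missing only `p` are not kernels. -/
def loose (J : Finset (Finset (Fin r))) : Finset (Fin r) := univ.filter fun p => {p}ᶜ ∉ J

/-- A set of colours is a kernel pattern unless its complement contains exactly one loose colour:
a set that does not contain exactly one loose colour is a union of non-loose singletons and of pairs
of loose colours. -/
theorem mem_of_card_ne_one (hu : univ ∈ J) (hi : ∀ P ∈ J, ∀ Q ∈ J, P ∩ Q ∈ J)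
    (hc : ∀ p p' : Fin r, p ≠ p' → {p}ᶜ ∈ J ∨ {p'}ᶜ ∈ J ∨ {p, p'}ᶜ ∈ J)
    {P : Finset (Fin r)} (hP : #(Pᶜ ∩ loose J) ≠ 1) : P ∈ J := by
  have hsing : ∀ p, p ∉ loose J → {p}ᶜ ∈ J := fun p hp => by
    simpa [loose] using hp
  have h1 : ((Pᶜ \ loose J).biUnion fun p => ({p} : Finset (Fin r)))ᶜ ∈ J :=
    biUnion_compl_mem hu hi _ _ fun p hp => hsing p (mem_sdiff.1 hp).2
  rcases (Pᶜ ∩ loose J).eq_empty_or_nonempty with h0 | ⟨p₀, hp₀⟩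
  · convert h1 using 1
    rw [biUnion_singleton_eq_self]
    ext x
    have hx : x ∉ Pᶜ ∩ loose J := by rw [h0]; simp
    simp only [mem_inter, mem_compl, mem_sdiff] at hx ⊢
    tauto
  · have h2 : (((Pᶜ ∩ loose J).erase p₀).biUnion fun p => ({p₀, p} : Finset (Fin r)))ᶜ ∈ J := by
      refine biUnion_compl_mem hu hi _ _ fun p hp => ?_
      rw [mem_erase, mem_inter] at hp
      have hl : ∀ x, x ∈ loose J → {x}ᶜ ∉ J := fun x hx => by simpa [loose] using hx
      rcases hc p₀ p hp.1.symm with h | h | h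
      · exact (hl _ (mem_inter.1 hp₀).2 h).elim
      · exact (hl _ hp.2.2 h).elim
      · exact h
    have hne : ((Pᶜ ∩ loose J).erase p₀).Nonempty := by
      rw [← card_pos, card_erase_of_mem hp₀]
      have := card_pos.2 ⟨p₀, hp₀⟩
      omega
    have h3 := hi _ h1 _ h2
    convert h3 using 1
    rw [biUnion_singleton_eq_self]
    obtain ⟨p₁, hp₁⟩ := hne
    ext x
    simp only [mem_inter, mem_compl, mem_sdiff, mem_biUnion, mem_erase, mem_insert,
      mem_singleton] at hp₀ hp₁ ⊢
    constructor
    · intro hx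
      refine ⟨by tauto, ?_⟩
      rintro ⟨y, hy, rfl | rfl⟩ <;> tauto
    · rintro ⟨hx1, hx2⟩
      by_contra hx
      by_cases hxl : x ∈ loose J
      · by_cases hxp : x = p₀
        · exact hx2 ⟨p₁, hp₁, Or.inl hxp⟩
        · exact hx2 ⟨x, ⟨hxp, hx, hxl⟩, Or.inr rfl⟩
      · exact hx1 ⟨hx, hxl⟩

theorem exists_card_inter_eq (L : Finset (Fin r)) {a t : ℕ} (ht : t ≤ #L) (hta : t ≤ a)
    (har : a - t ≤ r - #L) : ∃ P : Finset (Fin r), #P = a ∧ #(P ∩ L) = t := by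
  obtain ⟨S, hS, hSc⟩ := exists_subset_card_eq ht
  obtain ⟨S', hS', hSc'⟩ := exists_subset_card_eq (s := Lᶜ) (n := a - t)
    (by rw [card_compl, Fintype.card_fin]; exact har)
  have hd : Disjoint S S' := disjoint_left.2 fun x hx hx' => (mem_compl.1 (hS' hx')) (hS hx)
  refine ⟨S ∪ S', by rw [card_union_of_disjoint hd]; omega, ?_⟩
  rw [← hSc]
  congr 1
  ext x
  have h1 : x ∈ S → x ∈ L := fun h => hS h
  have h2 : x ∈ S' → x ∉ L := fun h => mem_compl.1 (hS' h)
  simp only [mem_inter, mem_union]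
  tauto

theorem card_compl_inter (P L : Finset (Fin r)) : #(Pᶜ ∩ L) = #L - #(P ∩ L) := by
  have h := card_sdiff_add_card_inter L P
  have h1 : Pᶜ ∩ L = L \ P := by ext; simp [and_comm]
  rw [h1, inter_comm P L]
  omega

/-- If no set of `a` colours is a kernel pattern together with its complement, then there is exactly
one loose colour, or all colours are loose and `a = 1` or `r - a = 1`, or `(r, a) = (4, 2)` and
exactly three colours are loose. -/
theorem card_loose_of_not_exists (hu : univ ∈ J) (hi : ∀ P ∈ J, ∀ Q ∈ J, P ∩ Q ∈ J)
    (hc : ∀ p p' : Fin r, p ≠ p' → {p}ᶜ ∈ J ∨ {p'}ᶜ ∈ J ∨ {p, p'}ᶜ ∈ J)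
    {a b : ℕ} (ha : 0 < a) (hb : 0 < b) (hab : a + b = r) (hr : 3 ≤ r)
    (hn : ¬ ∃ P ∈ J, #P = a ∧ Pᶜ ∈ J) :
    #(loose J) = 1 ∨ (#(loose J) = r ∧ (a = 1 ∨ b = 1)) ∨ (#(loose J) = 3 ∧ a = 2 ∧ b = 2) := by
  set L := loose J with hL
  have hLr : #L ≤ r := by simpa using card_le_univ L
  have key : ∀ t, t ≤ #L → t ≤ a → a - t ≤ r - #L → t = 1 ∨ #L - t = 1 := by
    intro t h1 h2 h3
    by_contra h
    push Not at h
    obtain ⟨P, hP, hPt⟩ := exists_card_inter_eq L h1 h2 h3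
    refine hn ⟨P, mem_of_card_ne_one hu hi hc ?_, hP, mem_of_card_ne_one hu hi hc ?_⟩
    · rw [← hL, card_compl_inter, hPt]; exact h.2
    · rw [← hL, compl_compl, hPt]; exact h.1
  have k0 := key 0
  have k1 := key #L
  have k2 := key a
  have k3 := key (a - 1)
  have k4 := key 2
  omega

theorem loose_eq_univ_of_card (h : #(loose J) = r) : loose J = univ :=
  (card_eq_iff_eq_univ _).1 (by simpa using h)

/-- With one loose colour `p`, all sets of colours containing `p` are kernel patterns; with all
colours loose, all sets of at most `r - 2` colours are. -/
theorem star_or_full_of_not_exists (hu : univ ∈ J) (hi : ∀ P ∈ J, ∀ Q ∈ J, P ∩ Q ∈ J)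
    (hc : ∀ p p' : Fin r, p ≠ p' → {p}ᶜ ∈ J ∨ {p'}ᶜ ∈ J ∨ {p, p'}ᶜ ∈ J)
    (hr : 3 ≤ r) (hn : ¬ ∃ P ∈ J, #P = 1 ∧ Pᶜ ∈ J) :
    (∃ p, ∀ P : Finset (Fin r), p ∈ P → P ∈ J) ∨ ∀ P : Finset (Fin r), #P ≤ r - 2 → P ∈ J := by
  rcases card_loose_of_not_exists hu hi hc one_pos (b := r - 1) (by omega) (by omega) hr hn with
    h | h | h
  · obtain ⟨p, hp⟩ := card_eq_one.1 h
    refine Or.inl ⟨p, fun P hP => mem_of_card_ne_one hu hi hc ?_⟩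
    rw [hp, inter_singleton_of_notMem (by simpa using hP)]
    simp
  · refine Or.inr fun P hP => mem_of_card_ne_one hu hi hc ?_
    rw [loose_eq_univ_of_card h.1, inter_univ, card_compl, Fintype.card_fin]
    omega
  · omega

/-- The pairs `(p, P)` such that `P` is a set of `a` colours not containing `p` for which
`insert p P` and `Pᶜ` are kernel patterns. -/
def anchors (J : Finset (Finset (Fin r))) (a : ℕ) : Finset (Fin r × Finset (Fin r)) :=
  univ.filter fun x => x.1 ∉ x.2 ∧ #x.2 = a ∧ insert x.1 x.2 ∈ J ∧ x.2ᶜ ∈ J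

/-- For `a ≥ 2` there are as many anchors as there are `a`-subsets of an `(r - 1)`-set. -/
theorem choose_le_card_anchors (hu : univ ∈ J) (hi : ∀ P ∈ J, ∀ Q ∈ J, P ∩ Q ∈ J)
    (hc : ∀ p p' : Fin r, p ≠ p' → {p}ᶜ ∈ J ∨ {p'}ᶜ ∈ J ∨ {p, p'}ᶜ ∈ J)
    {a b : ℕ} (ha : 2 ≤ a) (hb : 0 < b) (hab : a + b = r)
    (hn : ¬ ∃ P ∈ J, #P = a ∧ Pᶜ ∈ J) : (r - 1).choose a ≤ #(anchors J a) := by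
  have hmem : ∀ {P : Finset (Fin r)}, #(Pᶜ ∩ loose J) ≠ 1 → P ∈ J :=
    mem_of_card_ne_one hu hi hc
  rcases card_loose_of_not_exists hu hi hc (by omega) hb hab (by omega) hn with h | h | h
  · obtain ⟨p, hp⟩ := card_eq_one.1 h
    have hpJ : ∀ P : Finset (Fin r), p ∈ P → P ∈ J := fun P hP => by
      apply hmem
      rw [hp, inter_singleton_of_notMem (by simpa using hP)]
      simp
    have h1 : #(powersetCard a ({p}ᶜ : Finset (Fin r))) = (r - 1).choose a := by
      rw [card_powersetCard, card_compl, card_singleton, Fintype.card_fin]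
    rw [← h1]
    refine card_le_card_of_injOn (fun P => (p, P)) ?_ (by intro P _ Q _ h; simpa using h)
    intro P hP
    have hP' := mem_powersetCard.1 hP
    have hpP : p ∉ P := fun h => by simpa using hP'.1 h
    simp only [anchors, coe_filter, mem_univ, true_and, Set.mem_ofPred_eq]
    exact ⟨hpP, hP'.2, hpJ _ (mem_insert_self _ _), hpJ _ (mem_compl.2 hpP)⟩
  · -- here `b = 1`, and the anchors are the pairs `(p, {p}ᶜ)`
    have hb1 : a = r - 1 := by omega
    have hL := loose_eq_univ_of_card h.1
    subst hb1
    rw [Nat.choose_self, Nat.one_le_iff_ne_zero, ← Nat.pos_iff_ne_zero, card_pos]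
    refine ⟨(⟨0, by omega⟩, {⟨0, by omega⟩}ᶜ), ?_⟩
    simp only [anchors, mem_filter, mem_univ, true_and]
    refine ⟨by simp, by simp [card_compl], ?_, ?_⟩
    · rw [insert_compl_self]; exact hu
    · apply hmem
      rw [hL, compl_compl, inter_univ, card_compl, Fintype.card_fin, card_singleton]
      omega
  · -- the anchors are the pairs `(p, P)` with `p` loose and `P` the set of the other loose colours
    obtain ⟨h3, rfl, rfl⟩ := h
    have hr4 : r = 4 := by omega
    subst hr4
    have h1 : (4 - 1).choose 2 = #(loose J) := by rw [h3]; rfl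
    rw [h1]
    refine card_le_card_of_injOn (fun p => (p, (loose J).erase p)) ?_
      (by intro P _ Q _ h; exact (Prod.ext_iff.1 h).1)
    intro p hp
    have hp : p ∈ loose J := hp
    simp only [anchors, coe_filter, mem_univ, true_and, Set.mem_ofPred_eq]
    refine ⟨by simp, by rw [card_erase_of_mem hp, h3], ?_, ?_⟩
    · apply hmem
      rw [insert_erase hp, inter_comm, inter_compl]
      simp
    · apply hmem
      rw [compl_compl, inter_eq_left.2 (erase_subset _ _), card_erase_of_mem hp, h3]
      decide

end Pattern

/-! ### Building bushes greedily -/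

section Bush

variable {V : Type*} [DecidableEq V] {s h a b : ℕ}

/-- A bush is given by pairwise disjoint blocks `f u` of size `a` and `g w` of size `b`. -/
theorem containsCopy_of_blocks {H : Finset (Finset V)} (f : Option (Fin s × Fin h) → Finset V)
    (g : Fin s → Finset V) (hf : ∀ u, #(f u) = a) (hg : ∀ w, #(g w) = b)
    (hff : ∀ u u', u ≠ u' → Disjoint (f u) (f u')) (hgg : ∀ w w', w ≠ w' → Disjoint (g w) (g w'))
    (hfg : ∀ u w, Disjoint (f u) (g w)) (h0 : ∀ i, f none ∪ g i ∈ H)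
    (h1 : ∀ i j, f (some (i, j)) ∪ g i ∈ H) : ContainsCopy H (bush s h a b) := by
  classical
  have hφ : ∀ u, Nonempty (Fin a ≃ f u) := fun u =>
    ⟨(Fintype.equivFinOfCardEq (by simpa using hf u)).symm⟩
  have hψ : ∀ w, Nonempty (Fin b ≃ g w) := fun w =>
    ⟨(Fintype.equivFinOfCardEq (by simpa using hg w)).symm⟩
  obtain ⟨φ⟩ : Nonempty (∀ u, Fin a ≃ f u) := ⟨fun u => (hφ u).some⟩
  obtain ⟨ψ⟩ : Nonempty (∀ w, Fin b ≃ g w) := ⟨fun w => (hψ w).some⟩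
  let F : (Option (Fin s × Fin h) × Fin a) ⊕ (Fin s × Fin b) → V :=
    Sum.elim (fun x => (φ x.1 x.2 : V)) (fun x => (ψ x.1 x.2 : V))
  have hF : Function.Injective F := by
    rintro (⟨u, i⟩ | ⟨w, i⟩) (⟨u', i'⟩ | ⟨w', i'⟩) hxy
    · have hxy : (φ u i : V) = φ u' i' := hxy
      by_cases huu : u = u'
      · subst huu
        have := (φ u).injective (Subtype.ext hxy)
        rw [this]
      · exact (disjoint_left.1 (hff u u' huu) (φ u i).2 (hxy ▸ (φ u' i').2)).elim
    · have hxy : (φ u i : V) = ψ w' i' := hxy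
      exact (disjoint_left.1 (hfg u w') (φ u i).2 (hxy ▸ (ψ w' i').2)).elim
    · have hxy : (ψ w i : V) = φ u' i' := hxy
      exact (disjoint_left.1 (hfg u' w) (φ u' i').2 (hxy ▸ (ψ w i).2)).elim
    · have hxy : (ψ w i : V) = ψ w' i' := hxy
      by_cases hww : w = w'
      · subst hww
        have := (ψ w).injective (Subtype.ext hxy)
        rw [this]
      · exact (disjoint_left.1 (hgg w w' hww) (ψ w i).2 (hxy ▸ (ψ w' i').2)).elim
  refine ⟨⟨F, hF⟩, ?_⟩
  rintro e ⟨u, w, hadj, rfl⟩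
  have hmap : ((({u} : Finset (Option (Fin s × Fin h))) ×ˢ (univ : Finset (Fin a))).disjSum
      (({w} : Finset (Fin s)) ×ˢ (univ : Finset (Fin b)))).map ⟨F, hF⟩ = f u ∪ g w := by
    ext v
    simp only [mem_map, mem_disjSum, mem_product, mem_singleton, mem_univ, and_true,
      Function.Embedding.coeFn_mk, mem_union]
    constructor
    · rintro ⟨x, ⟨⟨u', i⟩, rfl, rfl⟩ | ⟨⟨w', i⟩, rfl, rfl⟩, rfl⟩
      · exact Or.inl (φ _ i).2
      · exact Or.inr (ψ _ i).2
    · rintro (hv | hv)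
      · refine ⟨Sum.inl (u, (φ u).symm ⟨v, hv⟩), Or.inl ⟨_, rfl, rfl⟩, ?_⟩
        simp [F]
      · refine ⟨Sum.inr (w, (ψ w).symm ⟨v, hv⟩), Or.inr ⟨_, rfl, rfl⟩, ?_⟩
        simp [F]
  rw [hmap]
  simp only [graphBush, SimpleGraph.fromRel_adj] at hadj
  obtain ⟨-, ⟨i, hi, hu⟩ | ⟨i, hi, -⟩⟩ := hadj
  · obtain rfl := Sum.inr_injective hi
    rcases hu with hu | ⟨j, hu⟩
    · obtain rfl := Sum.inl_injective hu
      exact h0 w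
    · obtain rfl := Sum.inl_injective hu
      exact h1 w j
  · simp at hi

/-- Greedy choice of pairwise disjoint sets `B i ⊇ X i`, when for each `i` the set `B i` may be
chosen so that outside its core `X i` it avoids any given bounded set. -/
theorem exists_disjoint_family {ι : Type*} [Fintype ι] [DecidableEq ι] (P : ι → Finset V → Prop)
    (X : ι → Finset V) (Z : Finset V) {c N : ℕ} (hX : ∀ i j, i ≠ j → Disjoint (X i) (X j))
    (hXZ : ∀ i, Disjoint (X i) Z) (hc : ∀ i B, P i B → #B ≤ c)
    (hN : #Z + 2 * (Fintype.card ι * c) ≤ N)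
    (hP : ∀ i W, #W ≤ N → ∃ B, P i B ∧ X i ⊆ B ∧ Disjoint (B \ X i) W) :
    ∃ B : ι → Finset V, (∀ i, P i (B i) ∧ X i ⊆ B i ∧ Disjoint (B i) Z) ∧
      ∀ i j, i ≠ j → Disjoint (B i) (B j) := by
  have hXc : ∀ i, #(X i) ≤ c := fun i => by
    obtain ⟨B, hB, hXB, -⟩ := hP i ∅ (by simp)
    exact (card_le_card hXB).trans (hc i B hB)
  suffices h : ∀ S : Finset ι, ∃ B : ι → Finset V,
      (∀ i ∈ S, P i (B i) ∧ X i ⊆ B i ∧ Disjoint (B i \ X i) (Z ∪ univ.biUnion X)) ∧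
      ∀ i ∈ S, ∀ j ∈ S, i ≠ j → Disjoint (B i) (B j) by
    obtain ⟨B, hB, hd⟩ := h univ
    refine ⟨B, fun i => ?_, fun i j => hd i (mem_univ i) j (mem_univ j)⟩
    obtain ⟨h1, h2, h3⟩ := hB i (mem_univ i)
    refine ⟨h1, h2, ?_⟩
    rw [← sdiff_union_of_subset h2, disjoint_union_left]
    exact ⟨h3.mono_right subset_union_left, hXZ i⟩
  intro S
  induction S using Finset.induction_on with
  | empty => exact ⟨fun _ => ∅, by simp, by simp⟩
  | insert i S hi ih =>
    obtain ⟨B, hB, hd⟩ := ih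
    have hW : #(Z ∪ univ.biUnion X ∪ S.biUnion B) ≤ N := by
      have h1 : #(univ.biUnion X) ≤ Fintype.card ι * c :=
        card_biUnion_le_card_mul _ _ _ fun j _ => hXc j
      have h2 : #(S.biUnion B) ≤ Fintype.card ι * c :=
        (card_biUnion_le_card_mul _ _ c fun j hj => hc j _ (hB j hj).1).trans
          (Nat.mul_le_mul_right _ (card_le_univ S))
      have h3 := card_union_le (Z ∪ univ.biUnion X) (S.biUnion B)
      have h4 := card_union_le Z (univ.biUnion X)
      omega
    obtain ⟨B', hB', hXB, hBW⟩ := hP i _ hW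
    have hne : ∀ j ∈ S, j ≠ i := fun j hj hji => hi (hji ▸ hj)
    have hdis : ∀ j ∈ S, Disjoint B' (B j) := by
      intro j hj
      rw [← sdiff_union_of_subset hXB, disjoint_union_left]
      refine ⟨hBW.mono_right ((subset_biUnion_of_mem B hj).trans subset_union_right), ?_⟩
      rw [← sdiff_union_of_subset (hB j hj).2.1, disjoint_union_right]
      refine ⟨((hB j hj).2.2.mono_right ?_).symm, hX i j (hne j hj).symm⟩
      exact (subset_biUnion_of_mem X (mem_univ i)).trans subset_union_right
    refine ⟨Function.update B i B', ?_, ?_⟩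
    · intro j hj
      rcases mem_insert.1 hj with rfl | hj
      · rw [Function.update_self]
        exact ⟨hB', hXB, hBW.mono_right subset_union_left⟩
      · rw [Function.update_of_ne (hne j hj)]
        exact hB j hj
    · intro j hj k hk hjk
      rcases mem_insert.1 hj with rfl | hj
      · rcases mem_insert.1 hk with rfl | hk
        · exact (hjk rfl).elim
        · rw [Function.update_self, Function.update_of_ne (hne k hk)]
          exact hdis k hk
      · rcases mem_insert.1 hk with rfl | hk
        · rw [Function.update_self, Function.update_of_ne (hne j ‹_›)]
          exact (hdis j ‹_›).symm
        · rw [Function.update_of_ne (hne j hj), Function.update_of_ne (hne k hk)]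
          exact hd j hj k hk hjk

/-- The number of vertices that have to be avoidable for the greedy construction of a bush. -/
def bushBound (r s h : ℕ) : ℕ := r + 2 * (s * r) + 2 * (s * h * r)

/-- Greedy construction of a bush with center `A`. The sets `X i` and `Y (i, j)` are prescribed
parts of the blocks that are to be chosen. -/
theorem containsCopy_of_candidates {H : Finset (Finset V)} {r N : ℕ} (hr : a + b = r)
    (hN : bushBound r s h ≤ N) {A : Finset V} (hA : #A = a) (X : Fin s → Finset V)
    (Y : Fin s × Fin h → Finset V) (hXX : ∀ i j, i ≠ j → Disjoint (X i) (X j))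
    (hYY : ∀ i j, i ≠ j → Disjoint (Y i) (Y j)) (hXY : ∀ i j, Disjoint (X i) (Y j))
    (hXA : ∀ i, Disjoint (X i) A) (hYA : ∀ j, Disjoint (Y j) A)
    (hcand : ∀ i W, #W ≤ N → ∃ B, #B = b ∧ A ∪ B ∈ H ∧ X i ⊆ B ∧ Disjoint (B \ X i) W ∧
      ∀ j W', #W' ≤ N → ∃ A', #A' = a ∧ A' ∪ B ∈ H ∧ Y (i, j) ⊆ A' ∧
        Disjoint (A' \ Y (i, j)) W') :
    ContainsCopy H (bush s h a b) := by
  have har : a ≤ r := by omega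
  have hbr : b ≤ r := by omega
  have hYc : ∀ j, #(Y j) ≤ a := by
    rintro ⟨i, j⟩
    obtain ⟨B, -, -, -, -, hB⟩ := hcand i ∅ (by simp)
    obtain ⟨A', hA', -, hYA', -⟩ := hB j ∅ (by simp)
    exact (card_le_card hYA').trans hA'.le
  have e1 : s * b ≤ s * r := Nat.mul_le_mul_left _ hbr
  have e2 : s * h * a ≤ s * h * r := Nat.mul_le_mul_left _ har
  obtain ⟨B, hB, hBB⟩ := exists_disjoint_family
    (fun i B => #B = b ∧ A ∪ B ∈ H ∧ ∀ j W', #W' ≤ N → ∃ A', #A' = a ∧ A' ∪ B ∈ H ∧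
      Y (i, j) ⊆ A' ∧ Disjoint (A' \ Y (i, j)) W') X (A ∪ univ.biUnion Y) (c := b) (N := N)
    hXX (fun i => disjoint_union_right.2 ⟨hXA i, (disjoint_biUnion_right _ _ _).2
      fun j _ => hXY i j⟩) (fun i B hB => hB.1.le)
    (by
      have h1 := card_union_le A (univ.biUnion Y)
      have h2 : #(univ.biUnion Y) ≤ s * h * a :=
        (card_biUnion_le_card_mul _ _ a fun j _ => hYc j).trans (by simp)
      simp only [bushBound, Fintype.card_fin] at *
      omega)
    (fun i W hW => by
      obtain ⟨B, h1, h2, h3, h4, h5⟩ := hcand i W hW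
      exact ⟨B, ⟨h1, h2, h5⟩, h3, h4⟩)
  have hBY : ∀ i j, Disjoint (B i) (Y j) := fun i j =>
    (hB i).2.2.mono_right ((subset_biUnion_of_mem Y (mem_univ j)).trans subset_union_right)
  have hBA : ∀ i, Disjoint (B i) A := fun i => (hB i).2.2.mono_right subset_union_left
  obtain ⟨A', hA', hAA⟩ := exists_disjoint_family
    (fun (x : Fin s × Fin h) A' => #A' = a ∧ A' ∪ B x.1 ∈ H) Y (A ∪ univ.biUnion B)
    (c := a) (N := N) hYY
    (fun j => disjoint_union_right.2 ⟨hYA j, (disjoint_biUnion_right _ _ _).2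
      fun i _ => (hBY i j).symm⟩) (fun _ A' hA' => hA'.1.le)
    (by
      have h1 := card_union_le A (univ.biUnion B)
      have h2 : #(univ.biUnion B) ≤ s * b :=
        (card_biUnion_le_card_mul _ _ b fun i _ => (hB i).1.1.le).trans (by simp)
      simp only [bushBound, Fintype.card_prod, Fintype.card_fin] at *
      omega)
    (fun x W hW => by
      obtain ⟨A', h1, h2, h3, h4⟩ := (hB x.1).1.2.2 x.2 W hW
      exact ⟨A', ⟨h1, h2⟩, h3, h4⟩)
  have hA'A : ∀ j, Disjoint (A' j) A := fun j => (hA' j).2.2.mono_right subset_union_left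
  refine containsCopy_of_blocks (fun u => u.elim A A') B ?_ (fun i => (hB i).1.1) ?_ hBB ?_
    (fun i => (hB i).1.2.1) (fun i j => (hA' (i, j)).1.2)
  · rintro (_ | x)
    · exact hA
    · exact (hA' x).1.1
  · rintro (_ | x) (_ | y) hxy
    · exact (hxy rfl).elim
    · exact (hA'A y).symm
    · exact hA'A x
    · exact hAA x y fun h => hxy (congrArg some h)
  · rintro (_ | x) w
    · exact (hBA w).symm
    · exact (hA' x).2.2.mono_right ((subset_biUnion_of_mem B (mem_univ w)).trans subset_union_right)

end Bush

/-! ### Kernels provide the blocks of a bush -/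

section Anchor

variable {V : Type*} [DecidableEq V] {r s h a b q : ℕ}

/-- The set `B` extends to edges of `H` by `a`-sets that avoid any given `N` vertices. -/
def Extendable (H : Finset (Finset V)) (N a : ℕ) (B : Finset V) : Prop :=
  ∀ W : Finset V, #W ≤ N → ∃ A : Finset V, #A = a ∧ A ∪ B ∈ H ∧ Disjoint A W

/-- The set `A` extends to edges of `H` by extendable `b`-sets that contain `x` and outside `x` avoid
any given `N` vertices; so `A` and such a `b`-set may serve as the center and the neighbor of the
center in a bush. -/
def Anchored (H : Finset (Finset V)) (N a b : ℕ) (A : Finset V) (x : V) : Prop :=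
  ∀ W : Finset V, #W ≤ N → ∃ B : Finset V, #B = b ∧ A ∪ B ∈ H ∧ x ∈ B ∧
    Disjoint (B \ {x}) W ∧ Extendable H N a B

theorem Homogeneous.extendable {κ : V → Fin r} {G H : Finset (Finset V)}
    {J : Finset (Finset (Fin r))} (hG : Homogeneous q κ G J) (hGH : G ⊆ H) {f : Finset V}
    (hf : f ∈ G) {P : Finset (Fin r)} (hP : P ∈ J) (hPc : #P + a = r) :
    Extendable H q a (part κ P f) := by
  intro W hW
  obtain ⟨g, hg, hgf, hd⟩ := hG.kernel P hP f hf W hW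
  have hsub : part κ P f ⊆ g := hgf ▸ part_subset _ _ _
  refine ⟨g \ part κ P f, ?_, by rw [sdiff_union_of_subset hsub]; exact hGH hg, hd⟩
  rw [card_sdiff_of_subset hsub, (hG.rainbow g hg).card_eq, (hG.rainbow f hf).card_part]
  omega

theorem part_union_part_compl (κ : V → Fin r) (P : Finset (Fin r)) (e : Finset V) :
    part κ P e ∪ part κ Pᶜ e = e := by
  rw [part_compl, union_sdiff_of_subset (part_subset _ _ _)]

theorem part_eq_of_part_eq {κ : V → Fin r} {P Q : Finset (Fin r)} (hPQ : P ⊆ Q) {e f : Finset V}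
    (h : part κ Q e = part κ Q f) : part κ P e = part κ P f := by
  rw [← inter_eq_left.2 hPQ, part_inter, part_inter]
  ext v
  have := congrArg (v ∈ ·) h
  simp only [mem_inter, mem_part, eq_iff_iff] at this ⊢
  have h2 : κ v ∈ P → κ v ∈ Q := fun h => hPQ h
  tauto

theorem Homogeneous.anchored {κ : V → Fin r} {G H : Finset (Finset V)}
    {J : Finset (Finset (Fin r))} (hG : Homogeneous q κ G J) (hGH : G ⊆ H) {e : Finset V}
    (he : e ∈ G) {x : V} (hx : x ∈ e) {P : Finset (Fin r)} (hxP : κ x ∉ P)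
    (hP : insert (κ x) P ∈ J) (hPc : Pᶜ ∈ J) (hab : a + b = r) (hPa : #P = a) :
    Anchored H q a b (part κ P e) x := by
  intro W hW
  obtain ⟨f, hf, hfe, hd⟩ := hG.kernel _ hP e he W hW
  have hxf : x ∈ part κ (insert (κ x) P) f := by
    rw [hfe]; exact mem_part.2 ⟨hx, mem_insert_self _ _⟩
  have hfe' : part κ P f = part κ P e := part_eq_of_part_eq (subset_insert _ _) hfe
  have hcard : #Pᶜ = b := by rw [card_compl, Fintype.card_fin]; omega
  refine ⟨part κ Pᶜ f, ?_, ?_, ?_, ?_, ?_⟩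
  · rw [(hG.rainbow f hf).card_part, hcard]
  · rw [← hfe', part_union_part_compl]; exact hGH hf
  · exact mem_part.2 ⟨part_subset _ _ _ hxf, mem_compl.2 hxP⟩
  · refine hd.mono_left fun v hv => ?_
    simp only [mem_sdiff, mem_part, mem_compl, mem_singleton, mem_insert, not_and, not_or] at hv ⊢
    refine ⟨hv.1.1, fun hve => ⟨fun hvx => hv.2 ?_, hv.1.2⟩⟩
    exact (hG.rainbow f hf).injOn hv.1.1 (part_subset _ _ _ hxf) hvx
  · exact hG.extendable hGH hf hPc (by omega)

theorem Homogeneous.containsCopy {κ : V → Fin r} {G H : Finset (Finset V)}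
    {J : Finset (Finset (Fin r))} (hG : Homogeneous q κ G J) (hGH : G ⊆ H) {e : Finset V}
    (he : e ∈ G) {P : Finset (Fin r)} (hP : P ∈ J) (hPc : Pᶜ ∈ J) (hab : a + b = r)
    (hPa : #P = a) (hq : bushBound r s h ≤ q) : ContainsCopy H (bush s h a b) := by
  have hcard : #Pᶜ = b := by rw [card_compl, Fintype.card_fin]; omega
  refine containsCopy_of_candidates hab hq (A := part κ P e)
    (by rw [(hG.rainbow e he).card_part, hPa]) (fun _ => ∅) (fun _ => ∅) (by simp) (by simp)
    (by simp) (by simp) (by simp) fun i W hW => ?_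
  obtain ⟨f, hf, hfe, hd⟩ := hG.kernel _ hP e he W hW
  refine ⟨part κ Pᶜ f, by rw [(hG.rainbow f hf).card_part, hcard], ?_, empty_subset _, ?_, ?_⟩
  · rw [← hfe, part_union_part_compl]; exact hGH hf
  · rw [sdiff_empty, part_compl, hfe]; exact hd
  · intro j W' hW'
    obtain ⟨A', h1, h2, h3⟩ := hG.extendable hGH hf hPc (a := a) (by omega) W' hW'
    exact ⟨A', h1, h2, empty_subset _, by simpa using h3⟩

/-- Distinct vertices anchoring the same set `A` are neighbors of a common center `A`. -/
theorem card_anchored_lt {H : Finset (Finset V)} (hab : a + b = r) (hq : bushBound r s h ≤ q)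
    (hfree : ¬ ContainsCopy H (bush s h a b)) {A : Finset V} (hA : #A = a) {S : Finset V}
    (hSA : Disjoint S A) (hS : ∀ x ∈ S, Anchored H q a b A x) : #S < s := by
  by_contra hlt
  push Not at hlt
  apply hfree
  obtain ⟨φ⟩ : Nonempty (Fin s ↪ S) :=
    Function.Embedding.nonempty_of_card_le (by simpa using hlt)
  refine containsCopy_of_candidates hab hq hA (fun i => {(φ i : V)}) (fun _ => ∅) ?_ (by simp)
    (by simp) ?_ (by simp) fun i W hW => ?_
  · intro i j hij
    rw [disjoint_singleton]
    exact fun h => hij (φ.injective (Subtype.ext h))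
  · intro i
    rw [disjoint_singleton_left]
    exact disjoint_left.1 hSA (φ i).2
  · obtain ⟨B, h1, h2, h3, h4, h5⟩ := hS _ (φ i).2 W hW
    refine ⟨B, h1, h2, singleton_subset_iff.2 h3, h4, fun j W' hW' => ?_⟩
    obtain ⟨A', h6, h7, h8⟩ := h5 W' hW'
    exact ⟨A', h6, h7, empty_subset _, by simpa using h8⟩

theorem part_compl_singleton {κ : V → Fin r} {e : Finset V} (he : Rainbow κ e) {x : V}
    (hx : x ∈ e) : part κ {κ x}ᶜ e = e.erase x := by
  ext v
  simp only [mem_part, mem_compl, mem_singleton, mem_erase]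
  constructor
  · rintro ⟨hv, hvx⟩; exact ⟨fun h => hvx (h ▸ rfl), hv⟩
  · rintro ⟨hvx, hv⟩; exact ⟨hv, fun h => hvx (he.injOn hv hx h)⟩

/-- If every edge of `H'` has at least `(r - 1).choose a` anchors, then in the absence of a bush
`H'` has at most `s - 1` edges per element of the shadow: every pair `A ⊆ D` with `D` in the
shadow and `#A = a` is responsible for at most `s - 1` anchored edges `insert x D`. -/
theorem card_le_of_anchors {H H' : Finset (Finset V)} (hab : a + b = r)
    (hb : 0 < b) (hq : bushBound r s h ≤ q) (hfree : ¬ ContainsCopy H (bush s h a b))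
    (hH : ∀ e ∈ H, #e = r) (hH' : H' ⊆ H)
    (han : ∀ e ∈ H', ∃ G ⊆ H, e ∈ G ∧ ∃ (κ : V → Fin r) (J : _), Homogeneous q κ G J ∧
      (r - 1).choose a ≤ #(anchors J a)) : #H' ≤ (s - 1) * #H.shadow := by
  classical
  set t : Finset (Σ _ : Finset V, Finset V) := H.shadow.sigma fun D => powersetCard a D with ht
  have htc : #t = #H.shadow * (r - 1).choose a := by
    rw [ht, card_sigma, sum_const_nat]
    intro D hD
    obtain ⟨e, he, x, hx, rfl⟩ := mem_shadow_iff.1 hD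
    rw [card_powersetCard, card_erase_of_mem hx, hH e he]
  have key := card_mul_le_card_mul (s := H') (t := t) (m := (r - 1).choose a) (n := s - 1)
    (fun e DA => ∃ x, x ∉ DA.1 ∧ insert x DA.1 = e ∧ Anchored H q a b DA.2 x) ?_ ?_
  · rw [htc] at key
    have hpos : 0 < (r - 1).choose a := Nat.choose_pos (by omega)
    refine Nat.le_of_mul_le_mul_right (key.trans (le_of_eq ?_)) hpos
    ring
  · intro e he
    obtain ⟨G, hGH, heG, κ, J, hG, hcard⟩ := han e he
    have hr := hG.rainbow e heG
    refine hcard.trans (card_le_card_of_injOn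
      (fun pP => ⟨part κ {pP.1}ᶜ e, part κ pP.2 e⟩) ?_ ?_)
    · rintro ⟨p, P⟩ hpP
      obtain ⟨hp, hPa, hPJ, hPcJ⟩ := (mem_filter.1 hpP).2
      obtain ⟨x, hx, rfl⟩ := hr.exists_mem p
      have hD := part_compl_singleton hr hx
      simp only [bipartiteAbove, coe_filter, Set.mem_ofPred_eq, ht, mem_sigma, mem_powersetCard]
      refine ⟨⟨?_, ?_, by rw [hr.card_part]; exact hPa⟩, x, ?_, ?_, ?_⟩
      · rw [hD]; exact mem_shadow_iff.2 ⟨e, hH' he, x, hx, rfl⟩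
      · intro v hv
        rw [mem_part] at hv ⊢
        exact ⟨hv.1, by rw [mem_compl, mem_singleton]; exact fun h => hp (h ▸ hv.2)⟩
      · rw [hD]; simp
      · rw [hD, insert_erase hx]
      · exact hG.anchored hGH heG hx hp hPJ hPcJ hab hPa
    · rintro ⟨p, P⟩ _ ⟨p', P'⟩ _ heq
      simp only [Sigma.mk.injEq, heq_eq_eq] at heq
      have h1 := congrArg (image κ) heq.1
      have h2 := congrArg (image κ) heq.2
      rw [hr.image_part, hr.image_part] at h1 h2
      rw [compl_inj_iff, singleton_inj] at h1
      rw [h1, h2]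
  · rintro ⟨D, A⟩ hDA
    rw [ht, mem_sigma, mem_powersetCard] at hDA
    set S := (H.biUnion id).filter fun x => x ∉ D ∧ Anchored H q a b A x with hS
    have hSs : #S < s := by
      refine card_anchored_lt hab hq hfree hDA.2.2 (disjoint_left.2 fun x hx hxA => ?_)
        fun x hx => (mem_filter.1 hx).2.2
      exact (mem_filter.1 hx).2.1 (hDA.2.1 hxA)
    have hsub : bipartiteBelow (fun (e : Finset V) (DA : Σ _ : Finset V, Finset V) =>
        ∃ x, x ∉ DA.1 ∧ insert x DA.1 = e ∧ Anchored H q a b DA.2 x) H' ⟨D, A⟩ ⊆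
          S.image fun x => insert x D := by
      intro f hf
      obtain ⟨hf, x, hxD, rfl, hx⟩ := mem_filter.1 hf
      exact mem_image.2 ⟨x, mem_filter.2 ⟨mem_biUnion.2 ⟨_, hH' hf, mem_insert_self _ _⟩,
        hxD, hx⟩, rfl⟩
    have := (card_le_card hsub).trans card_image_le
    omega

end Anchor

/-! ### Bushes with singletons as centers -/

section Singleton

variable {V : Type*} [DecidableEq V]

/-- In a long sequence of disjoint sets `B i` with bounded sets `Y i`, where each `B i` avoids the
earlier `Y j`, some `t` terms satisfy `Disjoint (B i) (Y j)` in both orders: keep the last term,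
discard the boundedly many earlier terms that meet its `Y`, and repeat. -/
theorem exists_independent_subset {B Y : ℕ → Finset V} {m : ℕ} (hY : ∀ i, #(Y i) ≤ m) (t : ℕ)
    (I : Finset ℕ) (hI : t * (m + 1) ≤ #I)
    (hB : ∀ i ∈ I, ∀ j ∈ I, j < i → Disjoint (B i) (B j) ∧ Disjoint (B i) (Y j)) :
    ∃ S ⊆ I, #S = t ∧ ∀ i ∈ S, ∀ j ∈ S, i ≠ j → Disjoint (B i) (B j) ∧ Disjoint (B i) (Y j) := by
  induction t generalizing I with
  | zero => exact ⟨∅, by simp, by simp, by simp⟩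
  | succ t ih =>
    have hne : I.Nonempty := card_pos.1 (by rw [add_mul] at hI; omega)
    set k := I.max' hne with hk
    have hkI : k ∈ I := I.max'_mem hne
    set I' := (I.erase k).filter fun i => Disjoint (Y k) (B i) with hI'
    have hlt : ∀ i ∈ I.erase k, i < k := fun i hi =>
      lt_of_le_of_ne (I.le_max' i (mem_of_mem_erase hi)) (ne_of_mem_erase hi)
    have hbad : #((I.erase k).filter fun i => ¬ Disjoint (Y k) (B i)) ≤ m := by
      refine le_trans ?_ (hY k)
      refine (card_le_card_biUnion (f := fun i => Y k ∩ B i) ?_ ?_).trans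
        (card_le_card (biUnion_subset.2 fun i _ => inter_subset_left))
      · intro i hi j hj hij
        have hi := mem_of_mem_erase (mem_filter.1 (mem_coe.1 hi)).1
        have hj := mem_of_mem_erase (mem_filter.1 (mem_coe.1 hj)).1
        have : Disjoint (B i) (B j) := by
          rcases lt_or_gt_of_ne hij with h | h
          · exact (hB j hj i hi h).1.symm
          · exact (hB i hi j hj h).1
        exact this.mono inter_subset_right inter_subset_right
      · intro i hi
        exact not_disjoint_iff_nonempty_inter.1 (mem_filter.1 hi).2
    have hcard := card_filter_add_card_filter_not (s := I.erase k) fun i => Disjoint (Y k) (B i)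
    rw [card_erase_of_mem hkI, ← hI'] at hcard
    have hsub : I' ⊆ I := (filter_subset _ _).trans (erase_subset _ _)
    obtain ⟨S, hS, hSc, hSd⟩ := ih I' (by rw [add_mul] at hI; omega)
      fun i hi j hj => hB i (hsub hi) j (hsub hj)
    have hkS : k ∉ S := fun h => by
      have := hlt k (mem_filter.1 (hS h)).1
      omega
    refine ⟨insert k S, insert_subset hkI (hS.trans hsub),
      by rw [card_insert_of_notMem hkS, hSc], ?_⟩
    intro i hi j hj hij
    rcases mem_insert.1 hi with rfl | hi'
    · rcases mem_insert.1 hj with rfl | hj'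
      · exact (hij rfl).elim
      · exact hB _ hkI j (hsub (hS hj')) (hlt j (mem_filter.1 (hS hj')).1)
    · rcases mem_insert.1 hj with rfl | hj'
      · have h := hB _ hkI i (hsub (hS hi')) (hlt i (mem_filter.1 (hS hi')).1)
        exact ⟨h.1.symm, (mem_filter.1 (hS hi')).2.symm⟩
      · exact hSd i hi' j hj' hij

/-- If pairs `(B, Y)` of bounded sets satisfying `C` can be chosen with `B` avoiding any given
bounded set, then there are `t` such pairs with all `B i` disjoint from each other and from the
`Y j` with `j ≠ i`. -/
theorem exists_independent_family (C : Finset V → Finset V → Prop) {c m N t : ℕ} (W : Finset V)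
    (hC : ∀ B Y, C B Y → #B ≤ c ∧ #Y ≤ m) (hN : #W + t * (m + 1) * (c + m) ≤ N)
    (hcand : ∀ W : Finset V, #W ≤ N → ∃ B Y, C B Y ∧ Disjoint B W) :
    ∃ B Y : Fin t → Finset V, (∀ i, C (B i) (Y i) ∧ Disjoint (B i) W) ∧
      ∀ i j, i ≠ j → Disjoint (B i) (B j) ∧ Disjoint (B i) (Y j) := by
  have hseq : ∀ n ≤ t * (m + 1), ∃ B Y : ℕ → Finset V, (∀ i, #(Y i) ≤ m) ∧
      ∀ i < n, C (B i) (Y i) ∧ Disjoint (B i) W ∧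
        ∀ j < i, Disjoint (B i) (B j) ∧ Disjoint (B i) (Y j) := by
    intro n
    induction n with
    | zero => exact fun _ => ⟨fun _ => ∅, fun _ => ∅, by simp, by simp⟩
    | succ n ih =>
      intro hn
      obtain ⟨B, Y, hY, hBY⟩ := ih (by omega)
      have hW : #(W ∪ (range n).biUnion fun i => B i ∪ Y i) ≤ N := by
        refine (card_union_le _ _).trans (le_trans (Nat.add_le_add_left ?_ _) hN)
        have h1 : #((range n).biUnion fun i => B i ∪ Y i) ≤ n * (c + m) :=
          (card_biUnion_le_card_mul _ _ (c + m) fun i hi =>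
            (card_union_le _ _).trans (add_le_add (hC _ _ (hBY i (mem_range.1 hi)).1).1
              (hY i))).trans (by simp)
        exact h1.trans (Nat.mul_le_mul_right _ (by omega))
      obtain ⟨B', Y', hC', hd⟩ := hcand _ hW
      rw [disjoint_union_right, disjoint_biUnion_right] at hd
      refine ⟨Function.update B n B', Function.update Y n Y', ?_, ?_⟩
      · intro i
        by_cases hi : i = n
        · subst hi; rw [Function.update_self]; exact (hC _ _ hC').2
        · rw [Function.update_of_ne hi]; exact hY i
      · intro i hi
        by_cases hin : i = n
        · subst hin
          rw [Function.update_self, Function.update_self]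
          refine ⟨hC', hd.1, fun j hj => ?_⟩
          rw [Function.update_of_ne hj.ne, Function.update_of_ne hj.ne]
          exact disjoint_union_right.1 (hd.2 j (mem_range.2 hj))
        · rw [Function.update_of_ne hin, Function.update_of_ne hin]
          obtain ⟨h1, h2, h3⟩ := hBY i (by omega)
          refine ⟨h1, h2, fun j hj => ?_⟩
          rw [Function.update_of_ne (by omega), Function.update_of_ne (by omega)]
          exact h3 j hj
  obtain ⟨B, Y, hY, hBY⟩ := hseq _ le_rfl
  obtain ⟨S, hS, hSc, hSd⟩ := exists_independent_subset (B := B) hY t (range (t * (m + 1)))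
    (by simp) fun i hi j _ hji => (hBY i (mem_range.1 hi)).2.2 j hji
  let φ := S.equivFinOfCardEq hSc
  refine ⟨fun i => B (φ.symm i), fun i => Y (φ.symm i), fun i => ?_, fun i j hij => ?_⟩
  · have := hBY _ (mem_range.1 (hS (φ.symm i).2))
    exact ⟨this.1, this.2.1⟩
  · exact hSd _ (φ.symm i).2 _ (φ.symm j).2 fun h => hij (φ.symm.injective (Subtype.ext h))

variable [Fintype V] {r s q : ℕ}

/-- The vertices that extend `D` to an edge of `H`. -/
def nbr (H : Finset (Finset V)) (D : Finset V) : Finset V :=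
  univ.filter fun x => x ∉ D ∧ insert x D ∈ H

theorem mem_nbr {H : Finset (Finset V)} {D : Finset V} {x : V} :
    x ∈ nbr H D ↔ x ∉ D ∧ insert x D ∈ H := by simp [nbr]

/-- Together with every other vertex of `e`, the vertex `x` can be used to start a branch of a
bush. -/
def IsStar (H : Finset (Finset V)) (q r : ℕ) (e : Finset V) (x : V) : Prop :=
  x ∈ e ∧ ∀ v ∈ e, v ≠ x → Anchored H q 1 (r - 1) {v} x

/-- Every vertex `v` of `e` is the kernel of a large sunflower of edges `insert v B` for which the
numbers of extensions of `B` and of `e.erase v`, truncated at `s + 1`, agree. -/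
def IsFull (H : Finset (Finset V)) (q r s : ℕ) (e : Finset V) : Prop :=
  ∀ v ∈ e, ∀ W : Finset V, #W ≤ q → ∃ B : Finset V, #B = r - 1 ∧ v ∉ B ∧ insert v B ∈ H ∧
    Disjoint B W ∧ min #(nbr H B) (s + 1) = min #(nbr H (e.erase v)) (s + 1)

/-- The truncated number of extensions of the facet of `e` that misses the colour `p`. -/
def facetDegree (H : Finset (Finset V)) (s : ℕ) (κ : V → Fin r) (e : Finset V) (p : Fin r) :
    Fin (s + 2) :=
  ⟨min #(nbr H (part κ {p}ᶜ e)) (s + 1), by omega⟩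

theorem isStar_or_isFull {H G : Finset (Finset V)} {κ : V → Fin r} {J : Finset (Finset (Fin r))}
    (hr : 3 ≤ r) (hG : Homogeneous q κ G J) (hGH : G ⊆ H) {e : Finset V} (he : e ∈ G)
    (hχ : ∀ f ∈ G, facetDegree H s κ f = facetDegree H s κ e) {h : ℕ}
    (hq : bushBound r s h ≤ q) (hfree : ¬ ContainsCopy H (bush s h 1 (r - 1))) :
    (∃ x, IsStar H q r e x) ∨ IsFull H q r s e := by
  have hre := hG.rainbow e he
  have hn : ¬ ∃ P ∈ J, #P = 1 ∧ Pᶜ ∈ J := fun ⟨P, hP, hPc, hPJ⟩ =>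
    hfree (hG.containsCopy hGH he hP hPJ (by omega) hPc hq)
  rcases star_or_full_of_not_exists hG.univ_mem hG.inter_mem hG.cover hr hn with ⟨p, hp⟩ | hJ
  · left
    obtain ⟨x, hx, rfl⟩ := hre.exists_mem p
    refine ⟨x, hx, fun v hv hvx => ?_⟩
    have hκ : κ x ∉ ({κ v} : Finset (Fin r)) := fun h =>
      hvx (hre.injOn hv hx (mem_singleton.1 h).symm)
    rw [← part_singleton hre hv]
    exact hG.anchored hGH he hx hκ (hp _ (mem_insert_self _ _)) (hp _ (mem_compl.2 hκ))
      (by omega) (card_singleton _)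
  · right
    intro v hv W hW
    obtain ⟨f, hf, hfe, hd⟩ := hG.kernel {κ v} (hJ _ (by rw [card_singleton]; omega)) e he W hW
    rw [part_singleton hre hv] at hfe hd
    have hrf := hG.rainbow f hf
    have hvf : v ∈ f := part_subset κ {κ v} f (by rw [hfe]; exact mem_singleton_self v)
    refine ⟨f.erase v, by rw [card_erase_of_mem hvf, hrf.card_eq], notMem_erase _ _, ?_, ?_, ?_⟩
    · rw [insert_erase hvf]; exact hGH hf
    · rwa [erase_eq]
    · have := congrArg Fin.val (congrFun (hχ f hf) (κ v))
      simpa only [facetDegree, part_compl_singleton hre hv, part_compl_singleton hrf hvf] using this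

/-- A facet of a full edge has at most `s` extensions: otherwise Hall's theorem gives distinct
second neighbors in a bush with center `{v}`. -/
theorem IsFull.card_nbr_le {H : Finset (Finset V)} {e : Finset V} (he : IsFull H q r s e)
    (hq : 1 + s * (s + 1) * (r + s) ≤ q) (hfree : ¬ ContainsCopy H (bush s 1 1 (r - 1)))
    {v : V} (hv : v ∈ e) : #(nbr H (e.erase v)) ≤ s := by
  by_contra hlt
  push Not at hlt
  apply hfree
  obtain ⟨B, Y, hBY, hd⟩ := exists_independent_family (t := s) (c := r) (m := s) (N := q)
    (fun B Y => #B = r - 1 ∧ #Y = s ∧ {v} ∪ B ∈ H ∧ Y ⊆ (nbr H B).erase v) {v}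
    (fun B Y h => ⟨by omega, by omega⟩) (by simpa using hq) (by
      intro W hW
      obtain ⟨B, hB, hvB, hBH, hd, hdeg⟩ := he v hv W hW
      have hvn : v ∈ nbr H B := mem_nbr.2 ⟨hvB, hBH⟩
      obtain ⟨Y, hY, hYc⟩ := exists_subset_card_eq (s := (nbr H B).erase v) (n := s)
        (by rw [card_erase_of_mem hvn]; omega)
      exact ⟨B, Y, ⟨hB, hYc, hBH, hY⟩, hd⟩)
  obtain ⟨y, hyinj, hy⟩ := (all_card_le_biUnion_card_iff_exists_injective Y).1 (by
    intro S
    rcases S.eq_empty_or_nonempty with rfl | ⟨i, hi⟩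
    · simp
    · calc #S ≤ s := by simpa using card_le_univ S
        _ = #(Y i) := (hBY i).1.2.1.symm
        _ ≤ _ := card_le_card (subset_biUnion_of_mem Y hi))
  have hyn : ∀ i, y i ≠ v ∧ y i ∉ B i ∧ insert (y i) (B i) ∈ H := fun i => by
    have h := mem_erase.1 ((hBY i).1.2.2.2 (hy i))
    exact ⟨h.1, mem_nbr.1 h.2⟩
  refine containsCopy_of_blocks (fun u => u.elim {v} fun x => {y x.1}) B ?_
    (fun i => (hBY i).1.1) ?_ (fun i j hij => (hd i j hij).1) ?_ (fun i => (hBY i).1.2.2.1)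
    (fun i j => by simpa using (hyn i).2.2)
  · rintro (_ | x) <;> simp
  · rintro (_ | x) (_ | x') hxx
    · exact (hxx rfl).elim
    · simpa using (hyn x'.1).1.symm
    · simpa using (hyn x.1).1
    · have : x.1 ≠ x'.1 := fun h => hxx (congrArg some (Prod.ext h (Subsingleton.elim _ _)))
      simpa using fun h => this (hyinj h)
  · rintro (_ | x) w
    · exact (hBY w).2.symm
    · change Disjoint {y x.1} (B w)
      rw [disjoint_singleton_left]
      by_cases hw : w = x.1
      · subst hw; exact (hyn _).2.1
      · exact fun h => disjoint_left.1 (hd w x.1 hw).2 h (hy x.1)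

open Classical in
/-- The extensions `x` of `D` for which the edge `insert x D` is a star at `x`. -/
noncomputable def starNbr (H : Finset (Finset V)) (q r : ℕ) (D : Finset V) : Finset V :=
  (nbr H D).filter fun x => IsStar H q r (insert x D) x

theorem mem_starNbr {H : Finset (Finset V)} {D : Finset V} {x : V} :
    x ∈ starNbr H q r D ↔ x ∈ nbr H D ∧ IsStar H q r (insert x D) x := by
  classical simp [starNbr]

theorem anchored_of_mem_starNbr {H : Finset (Finset V)} {D : Finset V} {x v : V}
    (hx : x ∈ starNbr H q r D) (hv : v ∈ D) : Anchored H q 1 (r - 1) {v} x := by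
  obtain ⟨hx, hs⟩ := mem_starNbr.1 hx
  exact hs.2 v (mem_insert_of_mem hv) fun h => (mem_nbr.1 hx).1 (h ▸ hv)

theorem card_starNbr_lt {H : Finset (Finset V)} {h : ℕ} (hr : 1 ≤ r) (hq : bushBound r s h ≤ q)
    (hfree : ¬ ContainsCopy H (bush s h 1 (r - 1))) {D : Finset V} (hD : D.Nonempty) :
    #(starNbr H q r D) < s := by
  obtain ⟨v, hv⟩ := hD
  refine card_anchored_lt (by omega) hq hfree (card_singleton v) ?_
    fun x hx => anchored_of_mem_starNbr hx hv
  rw [disjoint_singleton_right]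
  exact fun h => (mem_nbr.1 (mem_starNbr.1 h).1).1 hv

/-- If `s - 1` vertices `x ∈ X` start branches of a bush with center `{u}`, then a set `B` disjoint
from `X` with `insert u B ∈ H` has no extensions outside `insert u X`: such an extension would
complete the remaining branch. -/
theorem nbr_subset_of_anchored {H : Finset (Finset V)} (hr : 1 ≤ r)
    (hq : bushBound r s 1 ≤ q) (hfree : ¬ ContainsCopy H (bush s 1 1 (r - 1))) {X : Finset V}
    {u : V} (hX : #X + 1 = s) (huX : u ∉ X) (hXu : ∀ x ∈ X, Anchored H q 1 (r - 1) {u} x)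
    {B : Finset V} (hB : #B = r - 1) (huB : u ∉ B) (hBH : insert u B ∈ H) (hBX : Disjoint B X) :
    nbr H B ⊆ insert u X := by
  intro z hz
  obtain ⟨hzB, hzH⟩ := mem_nbr.1 hz
  by_contra hzX
  rw [mem_insert, not_or] at hzX
  apply hfree
  let φ : Fin s ≃ Option X := (Fintype.equivFinOfCardEq (by simpa using hX)).symm
  have hxX : ∀ x : X, (x : V) ∉ B := fun x h => disjoint_left.1 hBX h x.2
  refine containsCopy_of_candidates (by omega) hq (A := {u}) (card_singleton u)
    (fun i => (φ i).elim B fun x => {(x : V)}) (fun ij => (φ ij.1).elim {z} fun _ => ∅)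
    ?_ ?_ ?_ ?_ ?_ ?_
  · intro i j hij
    have hne : φ i ≠ φ j := fun h => hij (φ.injective h)
    rcases hi : φ i with _ | x <;> rcases hj : φ j with _ | x'
    · exact (hne (hi.trans hj.symm)).elim
    · simpa using hxX x'
    · simpa using hxX x
    · have : x ≠ x' := fun h => hne (by rw [hi, hj, h])
      exact disjoint_singleton.2 fun h => this (Subtype.ext h)
  · rintro ⟨i, i'⟩ ⟨j, j'⟩ hij
    have hne : φ i ≠ φ j := fun h =>
      hij (Prod.ext (φ.injective h) (Subsingleton.elim _ _))
    dsimp only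
    rcases hi : φ i with _ | x <;> rcases hj : φ j with _ | x'
    · exact (hne (hi.trans hj.symm)).elim
    all_goals simp
  · rintro i ⟨j, j'⟩
    dsimp only
    rcases hi : φ i with _ | x <;> rcases hj : φ j with _ | x'
    · simpa using hzB
    · simp
    · have : (x : V) ≠ z := fun h => hzX.2 (h ▸ x.2)
      simpa using this
    · simp
  · intro i
    rcases hi : φ i with _ | x
    · simpa using huB
    · have : (x : V) ≠ u := fun h => huX (h ▸ x.2)
      simpa using this
  · rintro ⟨j, j'⟩
    dsimp only
    rcases hj : φ j with _ | x
    · simpa using hzX.1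
    · simp
  · intro i W hW
    dsimp only
    rcases hi : φ i with _ | x
    · refine ⟨B, hB, hBH, subset_rfl, by simp, fun j W' _ => ⟨{z}, card_singleton z, hzH, ?_⟩⟩
      simp
    · obtain ⟨B', h1, h2, h3, h4, h5⟩ := hXu x x.2 W hW
      refine ⟨B', h1, h2, by simpa using h3, h4, fun j W' hW' => ?_⟩
      obtain ⟨A', h6, h7, h8⟩ := h5 W' hW'
      exact ⟨A', h6, h7, by simp, by simpa using h8⟩

/-- Let `u` and `x₁` be distinct vertices of a full edge `e`, and let `X` consist of `s - 1` star
extensions of `e.erase x₁`. If `e.erase u` has at least `s` extensions, then there are many sets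
`B` whose extensions are exactly the vertices of `insert u X`. -/
theorem IsFull.exists_nbr_eq {H : Finset (Finset V)} {e : Finset V} (he : IsFull H q r s e)
    (hr : 1 ≤ r) (hq : bushBound r s 1 ≤ q) (hfree : ¬ ContainsCopy H (bush s 1 1 (r - 1)))
    {u x₁ : V} (hu : u ∈ e) (hux : u ≠ x₁) {X : Finset V}
    (hXs : X ⊆ starNbr H q r (e.erase x₁)) (hX : #X + 1 = s) (hdeg : s ≤ #(nbr H (e.erase u)))
    (W : Finset V) (hW : #W + s ≤ q) :
    ∃ B : Finset V, #B = r - 1 ∧ Disjoint B W ∧ nbr H B = insert u X := by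
  have huD : u ∈ e.erase x₁ := mem_erase.2 ⟨hux, hu⟩
  have huX : u ∉ X := fun h => (mem_nbr.1 (mem_starNbr.1 (hXs h)).1).1 huD
  obtain ⟨B, hB, huB, hBH, hd, hBdeg⟩ := he u hu (W ∪ X) (by
    have := card_union_le W X
    omega)
  rw [disjoint_union_right] at hd
  refine ⟨B, hB, hd.1, eq_of_subset_of_card_le ?_ ?_⟩
  · exact nbr_subset_of_anchored hr hq hfree hX huX
      (fun x hx => anchored_of_mem_starNbr (hXs hx) huD) hB huB hBH hd.2
  · rw [card_insert_of_notMem huX]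
    omega

/-- A full edge that is not a star has at most one facet with `s - 1` star extensions. -/
theorem IsFull.eq_of_le_card_starNbr {H : Finset (Finset V)} {e : Finset V}
    (he : IsFull H q r s e) (heH : e ∈ H) (her : #e = r) (hr : 1 ≤ r) (hs : 2 ≤ s)
    (hq : bushBound r s 1 + s ≤ q) (hfree : ¬ ContainsCopy H (bush s 1 1 (r - 1)))
    (hstar : ∀ x, ¬ IsStar H q r e x) {u x₁ : V} (hu : u ∈ e) (hx₁ : x₁ ∈ e)
    (hsu : s ≤ #(starNbr H q r (e.erase u)) + 1) (hsx : s ≤ #(starNbr H q r (e.erase x₁)) + 1) :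
    u = x₁ := by
  by_contra hux
  have hout : ∀ v ∈ e, ∀ x ∈ starNbr H q r (e.erase v), x ∉ e := by
    intro v hv x hx hxe
    obtain ⟨hx, hxs⟩ := mem_starNbr.1 hx
    have hxv : x = v := by
      by_contra h
      exact (mem_nbr.1 hx).1 (mem_erase.2 ⟨h, hxe⟩)
    subst hxv
    rw [insert_erase hxe] at hxs
    exact hstar x hxs
  obtain ⟨X, hXs, hXc⟩ := exists_subset_card_eq (s := starNbr H q r (e.erase x₁)) (n := s - 1)
    (by omega)
  obtain ⟨X', hXs', hXc'⟩ := exists_subset_card_eq (s := starNbr H q r (e.erase u)) (n := s - 1)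
    (by omega)
  have hX : #X + 1 = s := by omega
  have hX' : #X' + 1 = s := by omega
  have hXe : ∀ x ∈ X, x ∉ e := fun x hx => hout x₁ hx₁ x (hXs hx)
  have hXe' : ∀ x ∈ X', x ∉ e := fun x hx => hout u hu x (hXs' hx)
  have hdeg : ∀ v ∈ e, ∀ Z ⊆ starNbr H q r (e.erase v), #Z + 1 = s →
      s ≤ #(nbr H (e.erase v)) := by
    intro v hv Z hZ hZc
    have hvZ : v ∉ Z := fun h => hout v hv v (hZ h) hv
    rw [← hZc, ← card_insert_of_notMem hvZ]
    refine card_le_card (insert_subset ?_ fun x hx => (mem_starNbr.1 (hZ hx)).1)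
    exact mem_nbr.2 ⟨notMem_erase _ _, by rwa [insert_erase hv]⟩
  have hdegu := hdeg u hu X' hXs' hX'
  have hdegx := hdeg x₁ hx₁ X hXs hX
  have hq' : bushBound r s 1 ≤ q := by omega
  -- the star extensions of the two facets agree
  have hsub : X' ⊆ X := by
    intro x hx
    have h := nbr_subset_of_anchored hr hq' hfree hX (fun h => hXe u h hu)
      (fun y hy => anchored_of_mem_starNbr (hXs hy) (mem_erase.2 ⟨hux, hu⟩))
      (B := e.erase u) (by rw [card_erase_of_mem hu, her]) (notMem_erase _ _)
      (by rwa [insert_erase hu])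
      (disjoint_left.2 fun v hv hvX => hXe v hvX (mem_of_mem_erase hv))
      (mem_starNbr.1 (hXs' hx)).1
    rcases mem_insert.1 h with rfl | h
    · exact (hXe' _ hx hu).elim
    · exact h
  obtain ⟨x₂, hx₂'⟩ : X'.Nonempty := card_pos.1 (by omega)
  have hx₂ := hsub hx₂'
  -- a bush with center `{x₂}` whose second neighbors are `u`, `x₁` and the vertices of `X \ {x₂}`
  set I := insert x₁ (insert u (X.erase x₂)) with hI
  have hIc : #I = s := by
    rw [hI, card_insert_of_notMem, card_insert_of_notMem, card_erase_of_mem hx₂]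
    · omega
    · exact fun h => hXe u (mem_of_mem_erase h) hu
    · rw [mem_insert, not_or]
      exact ⟨Ne.symm hux, fun h => hXe x₁ (mem_of_mem_erase h) hx₁⟩
  let φ : Fin s ≃ I := (I.equivFinOfCardEq hIc).symm
  have hIx₂ : ∀ y ∈ I, y ≠ x₂ := by
    rintro y hy rfl
    rcases mem_insert.1 hy with rfl | hy
    · exact hXe _ hx₂ hx₁
    rcases mem_insert.1 hy with rfl | hy
    · exact hXe _ hx₂ hu
    · exact notMem_erase _ _ hy
  have hcand : ∀ y ∈ I, ∀ W : Finset V, #W ≤ bushBound r s 1 → ∃ B : Finset V, #B = r - 1 ∧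
      Disjoint B W ∧ x₂ ∈ nbr H B ∧ y ∈ nbr H B := by
    intro y hy W hW
    rcases mem_insert.1 hy with rfl | hy
    · obtain ⟨B, h1, h2, h3⟩ := he.exists_nbr_eq hr hq' hfree hx₁ (Ne.symm hux) hXs' hX' hdegx W
        (by omega)
      exact ⟨B, h1, h2, h3 ▸ mem_insert_of_mem hx₂', h3 ▸ mem_insert_self _ _⟩
    · obtain ⟨B, h1, h2, h3⟩ := he.exists_nbr_eq hr hq' hfree hu hux hXs hX hdegu W (by omega)
      refine ⟨B, h1, h2, h3 ▸ mem_insert_of_mem hx₂, h3 ▸ ?_⟩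
      exact insert_subset_insert _ (erase_subset _ _) hy
  apply hfree
  refine containsCopy_of_candidates (r := r) (N := bushBound r s 1) (by omega) le_rfl (A := {x₂}) (card_singleton x₂)
    (fun _ => ∅) (fun ij => {(φ ij.1 : V)}) (by simp) ?_ (by simp) (by simp) ?_ ?_
  · rintro ⟨i, i'⟩ ⟨j, j'⟩ hij
    rw [disjoint_singleton]
    exact fun h => hij (Prod.ext (φ.injective (Subtype.ext h)) (Subsingleton.elim _ _))
  · intro j
    rw [disjoint_singleton]
    exact hIx₂ _ (φ j.1).2
  · intro i W hW
    obtain ⟨B, h1, h2, h3, h4⟩ := hcand _ (φ i).2 W hW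
    exact ⟨B, h1, (mem_nbr.1 h3).2, empty_subset _, by simpa using h2,
      fun j W' _ => ⟨{(φ i : V)}, card_singleton _, (mem_nbr.1 h4).2, subset_rfl, by simp⟩⟩

/-- Stars are charged to the facet opposite to their center, full edges with weight `1 / 2` to two
facets with at most `s - 2` star extensions. -/
theorem card_le_of_isStar_or_isFull {H H' : Finset (Finset V)} (hr : 3 ≤ r) (hs : 2 ≤ s)
    (hq : bushBound r s 1 + s ≤ q) (hq' : 1 + s * (s + 1) * (r + s) ≤ q)
    (hfree : ¬ ContainsCopy H (bush s 1 1 (r - 1))) (hH : ∀ e ∈ H, #e = r) (hH' : H' ⊆ H)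
    (hsf : ∀ e ∈ H', (∃ x, IsStar H q r e x) ∨ IsFull H q r s e) :
    #H' ≤ (s - 1) * #H.shadow := by
  classical
  set T := H'.filter fun e => ∃ x, IsStar H q r e x with hT
  set F := H'.filter fun e => ¬ ∃ x, IsStar H q r e x with hF
  have hTF : #T + #F = #H' := card_filter_add_card_filter_not _
  set n : Finset V → ℕ := fun D => #(starNbr H q r D) with hn
  have hTc : #T ≤ ∑ D ∈ H.shadow, n D := by
    have hsub : T ⊆ H.shadow.biUnion fun D => (starNbr H q r D).image fun x => insert x D := by
      intro e he
      obtain ⟨heH, x, hx⟩ := mem_filter.1 he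
      have heH := hH' heH
      refine mem_biUnion.2 ⟨e.erase x, mem_shadow_iff.2 ⟨e, heH, x, hx.1, rfl⟩,
        mem_image.2 ⟨x, mem_starNbr.2 ⟨mem_nbr.2 ⟨notMem_erase _ _, ?_⟩, ?_⟩, ?_⟩⟩
      · rwa [insert_erase hx.1]
      · rwa [insert_erase hx.1]
      · exact insert_erase hx.1
    exact (card_le_card hsub).trans (card_biUnion_le.trans (sum_le_sum fun D _ => card_image_le))
  have hFull : ∀ e ∈ F, e ∈ H ∧ IsFull H q r s e ∧ ∀ x, ¬ IsStar H q r e x := by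
    intro e he
    obtain ⟨heH, hns⟩ := mem_filter.1 he
    exact ⟨hH' heH, (hsf e heH).resolve_left hns, fun x hx => hns ⟨x, hx⟩⟩
  set R : Finset V → Finset V → Prop := fun e D => D ⊆ e ∧ n D + 2 ≤ s with hR
  have hFc : 2 * #F ≤ ∑ D ∈ H.shadow, #(bipartiteBelow R F D) := by
    rw [← sum_card_bipartiteAbove_eq_sum_card_bipartiteBelow, mul_comm, ← smul_eq_mul]
    refine card_nsmul_le_sum _ _ _ fun e he => ?_
    obtain ⟨heH, hef, hes⟩ := hFull e he
    have hbad : #(e.filter fun x => ¬ n (e.erase x) + 2 ≤ s) ≤ 1 := by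
      refine card_le_one.2 fun u hu x hx => ?_
      simp only [mem_filter, hn] at hu hx
      exact hef.eq_of_le_card_starNbr heH (hH e heH) (by omega) hs hq hfree hes hu.1 hx.1
        (by omega) (by omega)
    have hgood := card_filter_add_card_filter_not (s := e) fun x => n (e.erase x) + 2 ≤ s
    rw [hH e heH] at hgood
    refine le_trans (by omega) (card_le_card_of_injOn (s := e.filter fun x => n (e.erase x) + 2 ≤ s)
      (fun x => e.erase x) ?_ ?_)
    · intro x hx
      obtain ⟨hxe, hx⟩ := mem_filter.1 (mem_coe.1 hx)
      exact mem_coe.2 (mem_filter.2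
        ⟨mem_shadow_iff.2 ⟨e, heH, x, hxe, rfl⟩, erase_subset _ _, hx⟩)
    · intro x hx y hy hxy
      have hxe := (mem_filter.1 (mem_coe.1 hx)).1
      exact erase_injOn e hxe (mem_filter.1 (mem_coe.1 hy)).1 hxy
  have hD : ∀ D ∈ H.shadow, 2 * n D + #(bipartiteBelow R F D) ≤ 2 * (s - 1) := by
    intro D hD
    obtain ⟨e₀, he₀, x₀, hx₀, hD₀⟩ := mem_shadow_iff.1 hD
    have hDc : #D = r - 1 := by rw [← hD₀, card_erase_of_mem hx₀, hH e₀ he₀]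
    have hDn : D.Nonempty := card_pos.1 (by omega)
    have hlt : n D < s := card_starNbr_lt (by omega) (by omega) hfree hDn
    rcases (bipartiteBelow R F D).eq_empty_or_nonempty with h0 | ⟨e, he⟩
    · rw [h0, card_empty]; omega
    · have hext : ∀ f ∈ F, D ⊆ f → ∃ x, x ∉ D ∧ insert x D = f := by
        intro f hf hDf
        have h1 : #(f \ D) = 1 := by
          rw [card_sdiff_of_subset hDf, hH f (hFull f hf).1]; omega
        obtain ⟨x, hx⟩ := card_eq_one.1 h1
        have hxf : x ∈ f \ D := by rw [hx]; exact mem_singleton_self x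
        refine ⟨x, (mem_sdiff.1 hxf).2, ?_⟩
        rw [insert_eq, ← hx, sdiff_union_of_subset hDf]
      obtain ⟨heF, hDe, hDs⟩ := mem_filter.1 he
      obtain ⟨x, hxD, rfl⟩ := hext e heF hDe
      have hcod : #(nbr H D) ≤ s := by
        have := (hFull _ heF).2.1.card_nbr_le hq' hfree (mem_insert_self x D)
        rwa [erase_insert hxD] at this
      have hsub : bipartiteBelow R F D ⊆
          (nbr H D \ starNbr H q r D).image fun x => insert x D := by
        intro f hf
        obtain ⟨hfF, hDf, -⟩ := mem_filter.1 hf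
        obtain ⟨y, hyD, rfl⟩ := hext f hfF hDf
        refine mem_image.2 ⟨y, mem_sdiff.2 ⟨mem_nbr.2 ⟨hyD, (hFull _ hfF).1⟩, fun h => ?_⟩, rfl⟩
        exact (hFull _ hfF).2.2 y (mem_starNbr.1 h).2
      have h1 := (card_le_card hsub).trans card_image_le
      have hss : starNbr H q r D ⊆ nbr H D := fun y hy => (mem_starNbr.1 hy).1
      rw [card_sdiff_of_subset hss] at h1
      have h2 := card_le_card hss
      change _ ≤ _ - n D at h1
      change n D ≤ _ at h2
      omega
  have hsum := sum_le_sum hD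
  rw [sum_add_distrib, ← mul_sum, sum_const, smul_eq_mul] at hsum
  have : 2 * #H' ≤ 2 * ((s - 1) * #H.shadow) := by
    have h3 : #H.shadow * (2 * (s - 1)) = 2 * ((s - 1) * #H.shadow) := by ring
    omega
  omega

end Singleton
end BushTuran

theorem theorem3 (r s h : ℕ) (hr : 3 ≤ r) (hs : 0 < s) (hh : 0 < h) :
    ∃ C : ℝ, 0 < C ∧
      ∀ a b : ℕ, 0 < a → 0 < b → a + b = r →
        (a = 1 → h = 1 ∧ 2 ≤ s) →
        ∀ (V : Type*) [Fintype V] [DecidableEq V] (H : Finset (Finset V)),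
          (H : Set (Finset V)).Sized r →
          (H.card : ℝ) > ((s : ℝ) - 1) * (H.shadow.card : ℝ)
            + C * (Fintype.card V : ℝ) ^ (r - 2) →
          ContainsCopy H (bush s h a b) := by
  set q := 2 * r + BushTuran.bushBound r s h + s + (1 + s * (s + 1) * (r + s)) with hq
  obtain ⟨M, hM⟩ := BushTuran.exists_small_exceptional (r := r) (q := q) (by omega) (by omega)
    (by omega) (Fin r → Fin (s + 2))
  refine ⟨M + 1, by positivity, ?_⟩
  intro a b ha hb hab ha1 V _ _ H hH hcard
  by_contra hfree
  have hHr : ∀ e ∈ H, e.card = r := fun e he => hH he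
  obtain ⟨B, hBH, hBc, hgood⟩ := hM V H (fun κ => BushTuran.facetDegree H s κ) hHr
  have hmain : (H \ B).card ≤ (s - 1) * H.shadow.card := by
    rcases Nat.lt_or_ge a 2 with ha2 | ha2
    · obtain rfl : a = 1 := by omega
      obtain ⟨rfl, hs2⟩ := ha1 rfl
      obtain rfl : b = r - 1 := by omega
      refine BushTuran.card_le_of_isStar_or_isFull (q := q) hr hs2 (by omega) (by omega) hfree hHr
        Finset.sdiff_subset fun e he => ?_
      obtain ⟨heH, heB⟩ := Finset.mem_sdiff.1 he
      obtain ⟨G, hGH, heG, κ, J, hG, hχ⟩ := hgood e heH heB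
      exact BushTuran.isStar_or_isFull hr hG hGH heG hχ (by omega) hfree
    · refine BushTuran.card_le_of_anchors hab hb (q := q) (by omega) hfree hHr
        Finset.sdiff_subset fun e he => ?_
      obtain ⟨heH, heB⟩ := Finset.mem_sdiff.1 he
      obtain ⟨G, hGH, heG, κ, J, hG, -⟩ := hgood e heH heB
      refine ⟨G, hGH, heG, κ, J, hG, ?_⟩
      refine BushTuran.choose_le_card_anchors hG.univ_mem hG.inter_mem hG.cover ha2 hb hab ?_
      rintro ⟨P, hP, hPa, hPc⟩
      exact hfree (hG.containsCopy hGH heG hP hPc hab hPa (by omega))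
  have hle : H.card ≤ M * Fintype.card V ^ (r - 2) + (s - 1) * H.shadow.card := by
    have := Finset.card_sdiff_add_card_eq_card hBH
    omega
  have hle' : (H.card : ℝ) ≤ M * (Fintype.card V : ℝ) ^ (r - 2)
      + ((s : ℝ) - 1) * (H.shadow.card : ℝ) := by
    have h1 : ((s - 1 : ℕ) : ℝ) = (s : ℝ) - 1 := by
      rw [Nat.cast_sub hs, Nat.cast_one]
    rw [← h1]
    exact_mod_cast hle
  have hpos : (0 : ℝ) ≤ (Fintype.card V : ℝ) ^ (r - 2) := by positivity
  rw [add_mul] at hcard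
  linarith
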